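/- **Theorem (center manifold at $r=0$).** Let $\nu>0$ and $\alpha,\beta,\delta\in\mathbb R$ with $\alpha+\beta>0$. Let $\Phi\in C^1(0,1)$ with $\Phi'>0$ and $\kappa\in C^1(\mathbb R)$ with $\kappa'>0$. Consider the Keen system with zero interest rate $$\dot\omega=\omega[\Phi(\lambda)-\alpha],\qquad \dot\lambda=\lambda\Big[\frac{\kappa(1-\omega)}{\nu}-\alpha-\beta-\delta\Big],\qquad \dot d=d\Big[\delta-\frac{\kappa(1-\omega)}{\nu}\Big]+\kappa(1-\omega)-(1-\omega).$$ Let $\lambda_0\in(0,1)$ and $\pi_0\in\mathbb R$ satisfy $\Phi(\lambda_0)=\alpha$ and $\kappa(\pi_0)=\nu(\alpha+\beta+\delta)$, and put $$\omega_0=1-\pi_0,\qquad d_0=\frac{\nu(\alpha+\beta+\delta)-\pi_0}{\alpha+\beta}.$$ Assume $\omega_0>0$, that $\Phi$ is $C^2$ near $\lambda_0$ and that $\kappa$ is $C^2$ near $\pi_0$. Put $$K_0=\omega_0\Phi'(\lambda_0),\qquad K_1=\frac{\lambda_0\kappa'(\pi_0)}{\nu},\qquad K_2=\frac{(d_0-\nu)\kappa'(\pi_0)+\nu}{\nu},\qquad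 \Omega_0^2=K_0K_1=\frac{\omega_0\lambda_0}{\nu}\Phi'(\lambda_0)\kappa'(\pi_0).$$ Translate the system so that $(\omega_0,\lambda_0,d_0)$ becomes the origin, and let $F$ be the translated vector field. A *local $C^2$ center manifold* $d=h(\omega,\lambda)$ is the graph $W^c$ of a $C^2$ function $h:U\to\mathbb R$ on an open neighbourhood $U\subset\mathbb R^2$ of $(0,0)$ with $h(0,0)=0$, where the origin is an equilibrium of $F$, such that the tangent space of $W^c$ at the origin is the center subspace of $DF(0)$ (the real generalized eigenspace for the eigenvalues with zero real part), and such that every solution meeting $W^c$ stays in $W^c$, forwards and backwards in time, as long as its $(\omega,\lambda)$-component stays in $U$. Then a local two-dimensional $C^2$ center manifold $W^c=\{d=h(\omega,\lambda)\}$ with $h(0,0)=0$ exists. Moreover every such $W^c$ satisfies $$h(\omega,\lambda)=h_{10}\,\omega+h_{01}\,\lambda+O\big(\|(\omega,\lambda)\|^2\big)\quad\text{as }(\omega,\lambda)\to(0,0),$$ $$h_{10}=\frac{(\alpha+\beta)K_2}{(\alpha+\beta)^2+\Omega_0^2},\qquad h_{01}=-\frac{\omega_0\Phi'(\lambda_0)K_2}{(\alpha+\beta)^2+\Omega_0^2},$$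 and, if $K_2\neq0$, it is not tangent at the origin to the $(\omega,\lambda)$-plane $\{d=0\}$. -/

import Mathlib

open Set Filter Topology Asymptotics
open scoped TensorProduct

noncomputable section

/-! ### Local center manifolds that are graphs -/

section CenterManifold

variable {E : Type*} [NormedAddCommGroup E] [NormedSpace ℝ E]
variable {X : Type*} [NormedAddCommGroup X] [NormedSpace ℝ X]
variable {Y : Type*} [NormedAddCommGroup Y] [NormedSpace ℝ Y]

/-- The center subspace of a real linear operator `A`: the real vectors that lie, inside the
complexification, in the sum of the generalized eigenspaces of `A` for the eigenvalues with
zero real part. -/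
def centerSubspace (A : E →ₗ[ℝ] E) : Submodule ℝ E :=
  Submodule.comap (TensorProduct.mk ℝ ℂ E 1)
    ((⨆ μ : {μ : ℂ // μ.re = 0},
      Module.End.maxGenEigenspace (A.baseChange ℂ) (μ : ℂ)).restrictScalars ℝ)

/-- The vector field `F` in coordinates in which the point `p` is the origin. -/
def translateField (F : E → E) (p : E) : E → E := fun x => F (p + x)

/-- The graph `y = h x` over the set `U`. -/
def graphOver (U : Set X) (h : X → Y) : Set (X × Y) := {p | p.1 ∈ U ∧ p.2 = h p.1}

/-- The tangent space at the origin of the graph `y = h x`. -/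
def graphTangent (h : X → Y) : Submodule ℝ (X × Y) :=
  (fderiv ℝ h 0 : X →ₗ[ℝ] Y).graph

/-- The graph of `h` over the open neighbourhood `U` of `0` is a local `C²` center manifold
of `x' = F x` at the equilibrium `0`: it passes through `0`, it is tangent there to the center
subspace of the linearization `DF(0)`, and it is locally invariant: a solution that meets it
stays on it, forwards and backwards in time, as long as its `X`-component stays in `U`. -/
structure IsLocalCenterManifold (F : X × Y → X × Y) (U : Set X) (h : X → Y) : Prop where
  isOpen : IsOpen U
  zero_mem : (0 : X) ∈ U
  equilibrium : F 0 = 0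
  map_zero : h 0 = 0
  contDiffOn : ContDiffOn ℝ 2 h U
  tangent : graphTangent h = centerSubspace (fderiv ℝ F 0 : X × Y →ₗ[ℝ] X × Y)
  invariant : ∀ (a b : ℝ) (x : ℝ → X × Y),
    (∀ t ∈ Ioo a b, HasDerivAt x (F (x t)) t) → (∀ t ∈ Ioo a b, (x t).1 ∈ U) →
    ∀ t₀ ∈ Ioo a b, x t₀ ∈ graphOver U h → ∀ t ∈ Ioo a b, x t ∈ graphOver U h

end CenterManifold

/-! ### The Keen model -/

/-- The right-hand side of the Keen system in the variables `((ω, l), d)`: wage share `ω`,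
employment rate `l`, debt ratio `d`, with profit share `1 - ω - r * d`. -/
def keenField (r α β δ ν : ℝ) (Φ κ : ℝ → ℝ) : (ℝ × ℝ) × ℝ → (ℝ × ℝ) × ℝ :=
  fun p =>
    let ω := p.1.1
    let l := p.1.2
    let d := p.2
    let π := 1 - ω - r * d
    ((ω * (Φ l - α), l * (κ π / ν - α - β - δ)),
      d * (r - κ π / ν + δ) + κ π - (1 - ω))

/-- `K₂ = ((d₀ - ν) κ'(π₀) + ν) / ν`. -/
def keenK₂ (ν : ℝ) (κ : ℝ → ℝ) (π₀ d₀ : ℝ) : ℝ := ((d₀ - ν) * deriv κ π₀ + ν) / ν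

/-- `Ω₀² = K₀ K₁` with `K₀ = ω₀ Φ'(l₀)` and `K₁ = l₀ κ'(π₀) / ν`. -/
def keenΩsq (ν : ℝ) (Φ κ : ℝ → ℝ) (ω₀ l₀ π₀ : ℝ) : ℝ :=
  ω₀ * l₀ / ν * deriv Φ l₀ * deriv κ π₀

end

/-! At zero interest rate the profit share does not involve debt. The system is therefore a skew
product: an autonomous planar field `f` drives a scalar equation `y' = a(p) y + b(p)`, linear in
`y`, with `a(0) = -(α+β) < 0`. The planar part is of Lotka–Volterra type: separation of variables
gives a first integral with a strict minimum at the equilibrium, and after rescaling the axes its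
linearization is skew. Small sublevel sets of the integral are thus invariant neighbourhoods, and
the time-`τ` map `φ` of the flow has a derivative of norm close to 1 near the equilibrium.

A graph `y = h(p)` is invariant when `Dh · f = a h + b`. Variation of constants over a negative time
`τ` turns this into `h = B + T · (h ∘ φ)`, where `T = exp(-∫₀^τ a)` is less than 1 near the origin.
Since `T` contracts more than two derivatives of `φ` expand, a Neumann series gives a solution that
is `C²` (`exists_contDiffOn_two_fixedPoint`). The residual `Dh · f - a h - b` is bounded and
satisfies the homogeneous fixed-point equation, hence vanishes (`residual_transport`,
`eqOn_of_bounded_fixedPoint`). The `C²` dependence of the flow comes from the inverse function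
theorem on `C([-1,1], E)` (`exists_localFlow`). These parts combine in `exists_invariantGraph`.

The coefficients are linear algebra. The center subspace is the kernel of a left eigenvector for the
eigenvalue `-(α+β)` (`centerSubspace_eq_ker`), and this kernel is the graph of `(h₁₀, h₀₁)`.
Tangency alone then fixes `Dh(0)` for every center manifold, and `C²` regularity gives the quadratic
remainder. -/

/-! ### Linear fixed-point equations over a self-map -/

section FixedPoint

variable {E : Type*} [NormedAddCommGroup E] [NormedSpace ℝ E]
variable {F : Type*} [NormedAddCommGroup F] [NormedSpace ℝ F]
variable {G : Type*} [NormedAddCommGroup G] [NormedSpace ℝ G]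

/-- `g` is `C¹` on `V`, and is bounded there together with its derivative. -/
structure BddC1On (g : E → F) (V : Set E) : Prop where
  contDiffOn : ContDiffOn ℝ 1 g V
  bounded : ∃ C : ℝ, 0 ≤ C ∧ ∀ p ∈ V, ‖g p‖ ≤ C ∧ ‖fderiv ℝ g p‖ ≤ C

theorem BddC1On.hasFDerivAt {g : E → F} {V : Set E} (hg : BddC1On g V) (hV : IsOpen V) {p : E}
    (hp : p ∈ V) : HasFDerivAt g (fderiv ℝ g p) p :=
  ((hg.contDiffOn.contDiffAt (hV.mem_nhds hp)).differentiableAt one_ne_zero).hasFDerivAt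

theorem BddC1On.mono {g : E → F} {V W : Set E} (hg : BddC1On g V) (h : W ⊆ V) :
    BddC1On g W := by
  obtain ⟨C, hC, hb⟩ := hg.bounded
  exact ⟨hg.contDiffOn.mono h, C, hC, fun p hp => hb p (h hp)⟩

theorem BddC1On.add {g h : E → F} {V : Set E} (hV : IsOpen V) (hg : BddC1On g V)
    (hh : BddC1On h V) : BddC1On (fun p => g p + h p) V := by
  obtain ⟨C, hC, hb⟩ := hg.bounded
  obtain ⟨D, hD, hb'⟩ := hh.bounded
  refine ⟨hg.contDiffOn.add hh.contDiffOn, C + D, by positivity, fun p hp => ⟨?_, ?_⟩⟩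
  · exact (norm_add_le _ _).trans (add_le_add (hb p hp).1 (hb' p hp).1)
  · have h1 : HasFDerivAt (fun p => g p + h p) _ p :=
      (hg.hasFDerivAt hV hp).add (hh.hasFDerivAt hV hp)
    rw [h1.fderiv]
    exact (norm_add_le _ _).trans (add_le_add (hb p hp).2 (hb' p hp).2)

theorem BddC1On.comp {g : E → F} {φ : E → E} {V : Set E} (hV : IsOpen V) (hg : BddC1On g V)
    (hφ : BddC1On φ V) (hm : MapsTo φ V V) : BddC1On (fun p => g (φ p)) V := by
  obtain ⟨C, hC, hb⟩ := hg.bounded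
  obtain ⟨D, hD, hb'⟩ := hφ.bounded
  refine ⟨hg.contDiffOn.comp hφ.contDiffOn hm, C + C * D, by positivity, fun p hp => ⟨?_, ?_⟩⟩
  · exact (hb _ (hm hp)).1.trans (le_add_of_nonneg_right (by positivity))
  · have h1 : HasFDerivAt (fun p => g (φ p)) _ p :=
      (hg.hasFDerivAt hV (hm hp)).comp p (hφ.hasFDerivAt hV hp)
    rw [h1.fderiv]
    refine (ContinuousLinearMap.opNorm_comp_le _ _).trans ?_
    calc _ ≤ C * D := mul_le_mul (hb _ (hm hp)).2 (hb' p hp).2 (norm_nonneg _) hC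
      _ ≤ _ := le_add_of_nonneg_left hC

theorem BddC1On.bilinear {H : Type*} [NormedAddCommGroup H] [NormedSpace ℝ H]
    (L : F →L[ℝ] G →L[ℝ] H) {g : E → F} {h : E → G} {V : Set E} (hV : IsOpen V)
    (hg : BddC1On g V) (hh : BddC1On h V) : BddC1On (fun p => L (g p) (h p)) V := by
  obtain ⟨C, hC, hb⟩ := hg.bounded
  obtain ⟨D, hD, hb'⟩ := hh.bounded
  refine ⟨((L.contDiff.comp_contDiffOn hg.contDiffOn).clm_apply hh.contDiffOn),
    ‖L‖ * C * D + ‖L‖ * C * D, by positivity, fun p hp => ⟨?_, ?_⟩⟩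
  · have h1 : ‖L (g p) (h p)‖ ≤ ‖L‖ * C * D := by
      refine (L.le_opNorm₂ _ _).trans ?_
      gcongr
      exacts [(hb p hp).1, (hb' p hp).1]
    exact h1.trans (le_add_of_nonneg_right (by positivity))
  · have h1 := L.hasFDerivAt_of_bilinear (hg.hasFDerivAt hV hp) (hh.hasFDerivAt hV hp)
    rw [h1.fderiv]
    refine ContinuousLinearMap.opNorm_le_bound _ (by positivity) fun v => ?_
    have e1 : ‖L (g p) (fderiv ℝ h p v)‖ ≤ ‖L‖ * C * (D * ‖v‖) := by
      refine (L.le_opNorm₂ _ _).trans ?_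
      gcongr
      exacts [(hb p hp).1, (fderiv ℝ h p).le_of_opNorm_le (hb' p hp).2 v]
    have e2 : ‖L (fderiv ℝ g p v) (h p)‖ ≤ ‖L‖ * (C * ‖v‖) * D := by
      refine (L.le_opNorm₂ _ _).trans ?_
      gcongr
      exacts [(fderiv ℝ g p).le_of_opNorm_le (hb p hp).2 v, (hb' p hp).1]
    refine (norm_add_le _ _).trans ((add_le_add e1 e2).trans (le_of_eq ?_))
    ring

/-- The terms of the Neumann series for `H = B + T · (H ∘ φ)`. -/
def neumannTerm (φ : E → E) (T : E → F →L[ℝ] F) (B : E → F) : ℕ → E → F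
  | 0 => B
  | n + 1 => fun p => T p (neumannTerm φ T B n (φ p))

/-- The Neumann terms decay like powers of `q`. In their derivatives the chain rule contributes a
factor at most `q * m`, plus a term from `DT` of the size of the previous undifferentiated term.
Both series therefore converge geometrically and uniformly on `V`. -/
theorem exists_bddC1On_fixedPoint [CompleteSpace F] {V : Set E} (hV : IsOpen V) {φ : E → E}
    (hφ : ContDiffOn ℝ 1 φ V) (hm : MapsTo φ V V) {q m : ℝ} (hq0 : 0 ≤ q)
    (hφm : ∀ p ∈ V, ‖fderiv ℝ φ p‖ ≤ m) {T : E → F →L[ℝ] F} {B : E → F} (hT : BddC1On T V)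
    (hTq : ∀ p ∈ V, ‖T p‖ ≤ q) (hq : q < 1) (hqm : q * m < 1) (hB : BddC1On B V) :
    ∃ H : E → F, BddC1On H V ∧ ∀ p ∈ V, H p = B p + T p (H (φ p)) := by
  obtain ⟨C, hC, hbB⟩ := hB.bounded
  obtain ⟨M, hM, hbT⟩ := hT.bounded
  obtain ⟨Q, hQ1, hqQ, hqmQ⟩ : ∃ Q : ℝ, Q < 1 ∧ q ≤ Q ∧ q * m ≤ Q :=
    ⟨max q (q * m), max_lt hq hqm, le_max_left _ _, le_max_right _ _⟩
  have hQ0 : 0 ≤ Q := hq0.trans hqQ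
  -- The rate `P` is strictly above `Q`: the gap absorbs the `DT` term, and `K` below is chosen so
  -- that `M * C + Q * K ≤ P * K` closes the induction.
  obtain ⟨P, hQP, hP1⟩ := exists_between hQ1
  have hP0 : 0 ≤ P := hQ0.trans hQP.le
  set K : ℝ := C + M / (P - Q) * C with hK
  have hPQ : 0 < P - Q := sub_pos.2 hQP
  have hK0 : 0 ≤ K := by positivity
  have hMK : M * C + Q * K ≤ P * K := by
    have : (P - Q) * K = (P - Q) * C + M * C := by rw [hK]; field_simp
    nlinarith [mul_nonneg hPQ.le hC]
  set D := neumannTerm φ T B with hD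
  have hφd : ∀ p ∈ V, HasFDerivAt φ (fderiv ℝ φ p) p := fun p hp =>
    ((hφ.contDiffAt (hV.mem_nhds hp)).differentiableAt one_ne_zero).hasFDerivAt
  have key : ∀ n, ContDiffOn ℝ 1 (D n) V ∧
      ∀ p ∈ V, ‖D n p‖ ≤ C * P ^ n ∧ ‖fderiv ℝ (D n) p‖ ≤ K * P ^ n := by
    intro n
    induction n with
    | zero =>
      refine ⟨hB.contDiffOn, fun p hp => ⟨by simpa [hD, neumannTerm] using (hbB p hp).1, ?_⟩⟩
      have : C ≤ K := by rw [hK]; exact le_add_of_nonneg_right (by positivity)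
      simpa [hD, neumannTerm] using (hbB p hp).2.trans this
    | succ n ih =>
      obtain ⟨ih1, ih2⟩ := ih
      refine ⟨hT.contDiffOn.clm_apply (ih1.comp hφ hm), fun p hp => ⟨?_, ?_⟩⟩
      · calc ‖T p (D n (φ p))‖ ≤ ‖T p‖ * ‖D n (φ p)‖ := (T p).le_opNorm _
          _ ≤ P * (C * P ^ n) := by
            gcongr
            exacts [(hTq p hp).trans (hqQ.trans hQP.le), (ih2 _ (hm hp)).1]
          _ = C * P ^ (n + 1) := by ring
      · have hd : HasFDerivAt (D n) (fderiv ℝ (D n) (φ p)) (φ p) :=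
          ((ih1.contDiffAt (hV.mem_nhds (hm hp))).differentiableAt one_ne_zero).hasFDerivAt
        have h1 : HasFDerivAt (D (n + 1)) _ p :=
          (hT.hasFDerivAt hV hp).clm_apply (hd.comp p (hφd p hp))
        rw [h1.fderiv]
        have e1 : ‖(T p).comp ((fderiv ℝ (D n) (φ p)).comp (fderiv ℝ φ p))‖ ≤ Q * (K * P ^ n) := by
          calc _ ≤ ‖T p‖ * (‖fderiv ℝ (D n) (φ p)‖ * ‖fderiv ℝ φ p‖) :=
                (ContinuousLinearMap.opNorm_comp_le _ _).trans
                  (mul_le_mul_of_nonneg_left (ContinuousLinearMap.opNorm_comp_le _ _)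
                    (norm_nonneg _))
            _ ≤ q * (K * P ^ n * m) := by
                gcongr
                exacts [hTq p hp, (ih2 _ (hm hp)).2, hφm p hp]
            _ = (q * m) * (K * P ^ n) := by ring
            _ ≤ _ := by gcongr
        have e2 : ‖(fderiv ℝ T p).flip (D n (φ p))‖ ≤ M * (C * P ^ n) := by
          refine (ContinuousLinearMap.le_opNorm _ _).trans ?_
          rw [ContinuousLinearMap.opNorm_flip]
          gcongr
          exacts [(hbT p hp).2, (ih2 _ (hm hp)).1]
        refine (norm_add_le _ _).trans ((add_le_add e1 e2).trans ?_)
        calc _ = (M * C + Q * K) * P ^ n := by ring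
          _ ≤ (P * K) * P ^ n := by gcongr
          _ = _ := by ring
  have hsum : Summable fun n => P ^ n := summable_geometric_of_lt_one hP0 hP1
  have hpt : ∀ p ∈ V, Summable fun n => D n p := fun p hp =>
    Summable.of_norm_bounded (hsum.mul_left C) fun n => ((key n).2 p hp).1
  have hU' := tendstoUniformlyOn_tsum_nat (s := V) (f := fun n p => fderiv ℝ (D n) p)
    (hsum.mul_left K) fun n p hp => ((key n).2 p hp).2
  have hder : ∀ p ∈ V, HasFDerivAt (fun p => ∑' n, D n p) (∑' n, fderiv ℝ (D n) p) p := by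
    intro p hp
    refine hasFDerivAt_of_tendstoUniformlyOn hV hU' (f := fun N p => ∑ n ∈ Finset.range N, D n p)
      (fun N x hx => ?_) (fun x hx => (hpt x hx).hasSum.tendsto_sum_nat) hp
    exact HasFDerivAt.fun_sum fun n _ => (((key n).1.contDiffAt
      (hV.mem_nhds hx)).differentiableAt one_ne_zero).hasFDerivAt
  refine ⟨fun p => ∑' n, D n p, ⟨?_, ?_⟩, fun p hp => ?_⟩
  · rw [show (1 : WithTop ℕ∞) = 0 + 1 from rfl, contDiffOn_succ_iff_fderiv_of_isOpen hV]
    refine ⟨fun p hp => (hder p hp).differentiableAt.differentiableWithinAt, by simp,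
      contDiffOn_zero.2 ?_⟩
    refine (hU'.continuousOn (Frequently.of_forall fun N => ?_)).congr
      fun p hp => (hder p hp).fderiv
    refine continuousOn_finsetSum _ fun n _ => ?_
    exact ((key n).1.continuousOn_fderiv_of_isOpen hV le_rfl)
  · refine ⟨(C + K) * (∑' n, P ^ n), by positivity, fun p hp => ⟨?_, ?_⟩⟩
    · calc _ ≤ ∑' n, C * P ^ n := tsum_of_norm_bounded (hsum.mul_left C).hasSum
            fun n => ((key n).2 p hp).1
        _ = C * ∑' n, P ^ n := tsum_mul_left
        _ ≤ _ := by gcongr; linarith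
    · rw [(hder p hp).fderiv]
      calc _ ≤ ∑' n, K * P ^ n := tsum_of_norm_bounded (hsum.mul_left K).hasSum
            fun n => ((key n).2 p hp).2
        _ = K * ∑' n, P ^ n := tsum_mul_left
        _ ≤ _ := by gcongr; linarith
  · have := (hpt p hp).tsum_eq_zero_add
    simp only
    rw [this, (T p).map_tsum (hpt _ (hm hp))]
    rfl

/-- The difference of two solutions is reproduced by `T` along `φ`, so a bound `C` on it improves to
`q ^ n * C` for every `n`. -/
theorem eqOn_of_bounded_fixedPoint {E : Type*} {V : Set E} {φ : E → E} (hm : MapsTo φ V V) {q : ℝ}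
    (hq0 : 0 ≤ q) (hq : q < 1) {T : E → F →L[ℝ] F} {B : E → F} (hTq : ∀ p ∈ V, ‖T p‖ ≤ q)
    {H K : E → F} {C : ℝ} (hH : ∀ p ∈ V, H p = B p + T p (H (φ p)))
    (hK : ∀ p ∈ V, K p = B p + T p (K (φ p))) (hC : ∀ p ∈ V, ‖H p - K p‖ ≤ C) :
    EqOn H K V := by
  have h : ∀ n, ∀ p ∈ V, ‖H p - K p‖ ≤ q ^ n * C := by
    intro n
    induction n with
    | zero => simpa using hC
    | succ n ih =>
      intro p hp
      rw [hH p hp, hK p hp, add_sub_add_left_eq_sub, ← map_sub]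
      calc _ ≤ ‖T p‖ * ‖H (φ p) - K (φ p)‖ := (T p).le_opNorm _
        _ ≤ q * (q ^ n * C) := by
          gcongr
          exacts [hTq p hp, ih _ (hm hp)]
        _ = _ := by ring
  intro p hp
  have hl : Tendsto (fun n => q ^ n * C) atTop (𝓝 (0 * C)) :=
    (tendsto_pow_atTop_nhds_zero_of_lt_one hq0 hq).mul_const C
  rw [zero_mul] at hl
  exact sub_eq_zero.1 (norm_le_zero_iff.1 (ge_of_tendsto' hl fun n => h n p hp))

/-- A bounded solution of `H = B + T · (H ∘ φ)` is `C²` if `φ`, `T`, `B` are, provided `T`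
contracts more than `Dφ` expands. -/
theorem exists_contDiffOn_two_fixedPoint [CompleteSpace F] {V : Set E} (hV : IsOpen V)
    {φ : E → E} (hφ : BddC1On φ V) (hφ' : BddC1On (fderiv ℝ φ) V) (hm : MapsTo φ V V) {q m : ℝ}
    (hq0 : 0 ≤ q) (hm0 : 0 ≤ m) (hφm : ∀ p ∈ V, ‖fderiv ℝ φ p‖ ≤ m) {T : E → F →L[ℝ] F}
    {B : E → F} (hT : BddC1On T V) (hT' : BddC1On (fderiv ℝ T) V) (hTq : ∀ p ∈ V, ‖T p‖ ≤ q)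
    (hq : q < 1) (hqm : q * m < 1) (hqmm : q * m * m < 1) (hB : BddC1On B V)
    (hB' : BddC1On (fderiv ℝ B) V) :
    ∃ H : E → F, ContDiffOn ℝ 2 H V ∧ BddC1On H V ∧ ∀ p ∈ V, H p = B p + T p (H (φ p)) := by
  obtain ⟨H, hH, hfix⟩ := exists_bddC1On_fixedPoint hV hφ.contDiffOn hm hq0 hφm hT hTq hq hqm hB
  -- Differentiating the equation gives one of the same type for `DH`, namely `DH = A + S · (DH ∘
  -- φ)`. Here `S` has norm at most `q * m`, so the `C¹` theory applies again under `q * m * m < 1`;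
  -- uniqueness among bounded solutions identifies `DH` with the `C¹` solution `K`.
  set S : E → (E →L[ℝ] F) →L[ℝ] (E →L[ℝ] F) := fun p =>
    ((ContinuousLinearMap.compL ℝ E E F).flip (fderiv ℝ φ p)).comp
      (ContinuousLinearMap.compL ℝ E F F (T p)) with hS
  set A : E → E →L[ℝ] F := fun p => fderiv ℝ B p + (fderiv ℝ T p).flip (H (φ p)) with hA
  have hSapp : ∀ p (R : E →L[ℝ] F), S p R = (T p).comp (R.comp (fderiv ℝ φ p)) := by
    intro p R; ext v; simp [hS]
  have hSb : BddC1On S V := by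
    have := BddC1On.bilinear (H := (E →L[ℝ] F) →L[ℝ] (E →L[ℝ] F))
      (((ContinuousLinearMap.compL ℝ (E →L[ℝ] F) (E →L[ℝ] F) (E →L[ℝ] F)).bilinearComp
        (ContinuousLinearMap.compL ℝ E E F).flip (ContinuousLinearMap.compL ℝ E F F)))
      hV hφ' hT
    exact this
  have hAb : BddC1On A V := by
    refine hB'.add hV ?_
    have := BddC1On.bilinear
      (ContinuousLinearMap.flipₗᵢ ℝ E F F : (E →L[ℝ] F →L[ℝ] F) →L[ℝ] F →L[ℝ] E →L[ℝ] F)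
      hV hT' (hH.comp hV hφ hm)
    exact this
  have hSq : ∀ p ∈ V, ‖S p‖ ≤ q * m := by
    intro p hp
    refine ContinuousLinearMap.opNorm_le_bound _ (by positivity) fun R => ?_
    rw [hSapp]
    calc _ ≤ ‖T p‖ * (‖R‖ * ‖fderiv ℝ φ p‖) :=
          (ContinuousLinearMap.opNorm_comp_le _ _).trans
            (mul_le_mul_of_nonneg_left (ContinuousLinearMap.opNorm_comp_le _ _) (norm_nonneg _))
      _ ≤ q * (‖R‖ * m) := by
          gcongr
          exacts [hTq p hp, hφm p hp]
      _ = _ := by ring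
  obtain ⟨K, hK, hKfix⟩ := exists_bddC1On_fixedPoint hV hφ.contDiffOn hm (mul_nonneg hq0 hm0) hφm
    hSb hSq hqm hqmm hAb
  have hfix' : ∀ p ∈ V, fderiv ℝ H p = A p + S p (fderiv ℝ H (φ p)) := by
    intro p hp
    have h1 : HasFDerivAt (fun p => B p + T p (H (φ p))) _ p := (hB.hasFDerivAt hV hp).add
      ((hT.hasFDerivAt hV hp).clm_apply
        ((hH.hasFDerivAt hV (hm hp)).comp p (hφ.hasFDerivAt hV hp)))
    have h2 : H =ᶠ[𝓝 p] fun p => B p + T p (H (φ p)) :=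
      Filter.eventuallyEq_of_mem (hV.mem_nhds hp) hfix
    rw [h2.fderiv_eq, h1.fderiv, hSapp, hA]
    ext v
    simp only [add_apply]
    abel
  obtain ⟨C₁, _, hC₁⟩ := hH.bounded
  obtain ⟨C₂, _, hC₂⟩ := hK.bounded
  have heq : EqOn (fderiv ℝ H) K V :=
    eqOn_of_bounded_fixedPoint hm (mul_nonneg hq0 hm0) hqm hSq hfix' hKfix (C := C₁ + C₂)
      fun p hp => (norm_sub_le _ _).trans (add_le_add (hC₁ p hp).2 (hC₂ p hp).1)
  refine ⟨H, ?_, hH, hfix⟩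
  rw [show (2 : WithTop ℕ∞) = 1 + 1 from (one_add_one_eq_two).symm,
    contDiffOn_succ_iff_fderiv_of_isOpen hV]
  exact ⟨hH.contDiffOn.differentiableOn one_ne_zero, by simp, hK.contDiffOn.congr heq⟩

/-- A map that is `C²` at a point is, near that point, `C¹` with bounds together with its
derivative. -/
theorem ContDiffAt.eventually_bddC1On {g : E → F} {x : E} (hg : ContDiffAt ℝ 2 g x) :
    ∃ r > 0, BddC1On g (Metric.ball x r) ∧ BddC1On (fderiv ℝ g) (Metric.ball x r) := by
  have h1 : ContDiffAt ℝ 1 (fderiv ℝ g) x := hg.fderiv_right (by norm_num [one_add_one_eq_two])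
  have h0 : ContDiffAt ℝ 0 (fderiv ℝ (fderiv ℝ g)) x := h1.fderiv_right (by norm_num)
  have b0 := hg.continuousAt.norm.eventually (gt_mem_nhds (lt_add_one _))
  have b1 := h1.continuousAt.norm.eventually (gt_mem_nhds (lt_add_one _))
  have b2 : ∀ᶠ p in 𝓝 x, ‖fderiv ℝ (fderiv ℝ g) p‖ < ‖fderiv ℝ (fderiv ℝ g) x‖ + 1 :=
    (ContinuousAt.norm (E := E →L[ℝ] E →L[ℝ] F) h0.continuousAt).eventually (gt_mem_nhds (lt_add_one _))
  have c0 := hg.eventually (by simp)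
  obtain ⟨r, hr, h⟩ := Metric.eventually_nhds_iff_ball.1 (b0.and (b1.and (b2.and c0)))
  refine ⟨r, hr, ⟨?_, max (‖g x‖ + 1) (‖fderiv ℝ g x‖ + 1), by positivity, ?_⟩, ⟨?_,
    max (‖fderiv ℝ g x‖ + 1) (‖fderiv ℝ (fderiv ℝ g) x‖ + 1), by positivity, ?_⟩⟩
  · exact fun p hp => ((h p hp).2.2.2.of_le (by norm_num)).contDiffWithinAt
  · exact fun p hp => ⟨(h p hp).1.le.trans (le_max_left _ _), (h p hp).2.1.le.trans
      (le_max_right _ _)⟩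
  · exact fun p hp => ((h p hp).2.2.2.fderiv_right
      (by norm_num [one_add_one_eq_two])).contDiffWithinAt
  · exact fun p hp => ⟨(h p hp).2.1.le.trans (le_max_left _ _), (h p hp).2.2.1.le.trans
      (le_max_right _ _)⟩

end FixedPoint

/-! ### Superposition operators on spaces of continuous maps -/

section Superposition

variable {E F : Type*} [NormedAddCommGroup E] [NormedAddCommGroup F]
variable {K : Type*} [TopologicalSpace K]

/-- The superposition operator `x ↦ f ∘ x`. -/
def superposition (K : Type*) [TopologicalSpace K] {f : E → F} (hf : Continuous f)
    (x : C(K, E)) : C(K, F) := (⟨f, hf⟩ : C(E, F)).comp x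

@[simp]
theorem superposition_apply {f : E → F} (hf : Continuous f) (x : C(K, E)) (t : K) :
    superposition K hf x t = f (x t) := rfl

theorem continuous_superposition {f : E → F} (hf : Continuous f) :
    Continuous (superposition K hf) := ContinuousMap.continuous_postcomp _

variable [NormedSpace ℝ E] [NormedSpace ℝ F] [CompactSpace K]

/-- Pointwise application of a continuous family of operators to a continuous map. -/
noncomputable def pointwiseApply : C(K, E →L[ℝ] F) →L[ℝ] C(K, E) →L[ℝ] C(K, F) :=
  LinearMap.mkContinuous₂
    (LinearMap.mk₂ ℝ (fun (A : C(K, E →L[ℝ] F)) (x : C(K, E)) =>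
        (⟨fun t => A t (x t), A.continuous.clm_apply x.continuous⟩ : C(K, F)))
      (fun _ _ _ => by ext; simp) (fun _ _ _ => by ext; simp)
      (fun _ _ _ => by ext; simp) (fun _ _ _ => by ext; simp)) 1
    (fun A x => by
      rw [one_mul]
      refine (ContinuousMap.norm_le _ (by positivity)).2 fun t => ?_
      exact ((A t).le_opNorm _).trans
        (mul_le_mul (A.norm_coe_le_norm t) (x.norm_coe_le_norm t) (norm_nonneg _)
          (norm_nonneg (E := C(K, E →L[ℝ] F)) A)))

@[simp]
theorem pointwiseApply_apply (A : C(K, E →L[ℝ] F)) (x : C(K, E)) (t : K) :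
    pointwiseApply A x t = A t (x t) := rfl

/-- The mean value inequality on the segment from `x t` to `x t + v t` gives the remainder estimate.
It is uniform in `t` because `x ↦ Df ∘ x` is continuous for the sup norm. -/
theorem hasFDerivAt_superposition {f : E → F} (hf : ContDiff ℝ 1 f) (x : C(K, E)) :
    HasFDerivAt (superposition K hf.continuous)
      (pointwiseApply (superposition K (hf.continuous_fderiv one_ne_zero) x)) x := by
  rw [hasFDerivAt_iff_isLittleO_nhds_zero, Asymptotics.isLittleO_iff]
  intro c hc
  have hcont := (continuous_superposition (K := K)
    (hf.continuous_fderiv one_ne_zero)).continuousAt (x := x)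
  obtain ⟨r, hr, hball⟩ := Metric.continuousAt_iff.1 hcont c hc
  filter_upwards [Metric.ball_mem_nhds (0 : C(K, E)) hr] with v hv
  rw [mem_ball_zero_iff] at hv
  refine (ContinuousMap.norm_le _ (by positivity)).2 fun t => ?_
  have h1 : ∀ z ∈ segment ℝ (x t) (x t + v t), ‖fderiv ℝ f z - fderiv ℝ f (x t)‖ ≤ c := by
    intro z hz
    obtain ⟨θ, hθ, rfl⟩ := (segment_eq_image' ℝ (x t) (x t + v t)) ▸ hz
    have h2 : dist (x + θ • v) x < r := by
      rw [dist_eq_norm, add_sub_cancel_left, norm_smul, Real.norm_of_nonneg hθ.1]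
      exact (mul_le_of_le_one_left (norm_nonneg _) hθ.2).trans_lt hv
    have h3 := (ContinuousMap.dist_apply_le_dist t).trans (hball h2).le
    simpa [dist_eq_norm] using h3
  have h4 := Convex.norm_image_sub_le_of_norm_fderiv_le' (𝕜 := ℝ) (f := f)
    (fun z _ => hf.differentiable one_ne_zero z) h1 (convex_segment _ _)
    (left_mem_segment ℝ _ _) (right_mem_segment ℝ _ _)
  simp only [add_sub_cancel_left] at h4
  refine le_trans ?_ (h4.trans (mul_le_mul_of_nonneg_left (v.norm_coe_le_norm t) hc.le))
  simp

/-- The derivative is the superposition operator of `Df` followed by a bounded linear map, so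
regularity climbs one order at a time. -/
theorem contDiff_superposition_succ {n : ℕ} {f : E → F} (hf : ContDiff ℝ 1 f)
    (h : ContDiff ℝ n (superposition K (hf.continuous_fderiv one_ne_zero))) :
    ContDiff ℝ (n + 1) (superposition K hf.continuous) := by
  have hA : ContDiff ℝ n fun A : C(K, E →L[ℝ] F) => pointwiseApply (K := K) A :=
    ContinuousLinearMap.contDiff _
  exact contDiff_succ_iff_hasFDerivAt.2
    ⟨_, hA.comp h, fun x => hasFDerivAt_superposition hf x⟩

theorem contDiff_two_superposition {f : E → F} (hf : ContDiff ℝ 2 f) :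
    ContDiff ℝ 2 (superposition K hf.continuous) := by
  have h1 : ContDiff ℝ 1 (fderiv ℝ f) := hf.fderiv_right (by norm_num [one_add_one_eq_two])
  have h2 := contDiff_superposition_succ (K := K) (n := 0) h1
    (contDiff_zero.2 (continuous_superposition _))
  have h3 := contDiff_superposition_succ (K := K) (n := 1) (hf.of_le (by norm_num))
    (by simpa using h2)
  simpa [one_add_one_eq_two] using h3

end Superposition

/-! ### Integration of continuous curves on `[-1, 1]` -/

section Primitive

variable {E : Type*} [NormedAddCommGroup E]

/-- The extension of a curve on `[-1, 1]` to the line which is constant on both sides. -/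
noncomputable def extendCurve (x : C(Icc (-1 : ℝ) 1, E)) : ℝ → E :=
  IccExtend (by norm_num : (-1 : ℝ) ≤ 1) x

theorem continuous_extendCurve (x : C(Icc (-1 : ℝ) 1, E)) : Continuous (extendCurve x) :=
  x.continuous.Icc_extend'

theorem extendCurve_of_mem (x : C(Icc (-1 : ℝ) 1, E)) {t : ℝ} (ht : t ∈ Icc (-1 : ℝ) 1) :
    extendCurve x t = x ⟨t, ht⟩ := IccExtend_of_mem _ _ ht

theorem norm_extendCurve_le (x : C(Icc (-1 : ℝ) 1, E)) (t : ℝ) : ‖extendCurve x t‖ ≤ ‖x‖ :=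
  x.norm_coe_le_norm _

variable [NormedSpace ℝ E]

/-- The primitive vanishing at `0` of a curve on `[-1, 1]`. -/
noncomputable def primitive : C(Icc (-1 : ℝ) 1, E) →L[ℝ] C(Icc (-1 : ℝ) 1, E) :=
  LinearMap.mkContinuous
    { toFun := fun x => ⟨fun t => ∫ s in (0 : ℝ)..t, extendCurve x s,
        (intervalIntegral.continuous_primitive
          (fun a b => (continuous_extendCurve x).intervalIntegrable a b) 0).comp
          continuous_subtype_val⟩
      map_add' := fun x y => by
        ext t
        simp only [ContinuousMap.coe_mk, ContinuousMap.add_apply]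
        rw [← intervalIntegral.integral_add ((continuous_extendCurve x).intervalIntegrable _ _)
          ((continuous_extendCurve y).intervalIntegrable _ _)]
        rfl
      map_smul' := fun c x => by
        ext t
        simp only [ContinuousMap.coe_mk, ContinuousMap.smul_apply, RingHom.id_apply]
        rw [← intervalIntegral.integral_smul]
        rfl } 1
    (fun x => by
      rw [one_mul]
      refine (ContinuousMap.norm_le _ (norm_nonneg _)).2 fun t => ?_
      refine (intervalIntegral.norm_integral_le_of_norm_le_const
        fun s _ => norm_extendCurve_le x s).trans ?_
      rw [sub_zero]
      exact mul_le_of_le_one_right (norm_nonneg _) (abs_le.2 t.2))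

theorem primitive_apply (x : C(Icc (-1 : ℝ) 1, E)) (t : Icc (-1 : ℝ) 1) :
    primitive x t = ∫ s in (0 : ℝ)..t, extendCurve x s := rfl

theorem norm_primitive_apply_le (x : C(Icc (-1 : ℝ) 1, E)) : ‖primitive x‖ ≤ ‖x‖ := by
  refine (ContinuousMap.norm_le _ (norm_nonneg _)).2 fun t => ?_
  refine (intervalIntegral.norm_integral_le_of_norm_le_const
    fun s _ => norm_extendCurve_le x s).trans ?_
  rw [sub_zero]
  exact mul_le_of_le_one_right (norm_nonneg _) (abs_le.2 t.2)

theorem extendCurve_primitive [CompleteSpace E] (x : C(Icc (-1 : ℝ) 1, E)) {t : ℝ}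
    (ht : t ∈ Ioo (-1 : ℝ) 1) :
    HasDerivAt (extendCurve (primitive x)) (extendCurve x t) t := by
  have h := intervalIntegral.integral_hasDerivAt_right
    ((continuous_extendCurve x).intervalIntegrable 0 t)
    ((continuous_extendCurve x).stronglyMeasurableAtFilter _ _)
    (continuous_extendCurve x).continuousAt
  refine h.congr_of_eventuallyEq ?_
  filter_upwards [isOpen_Ioo.mem_nhds ht] with s hs
  rw [extendCurve_of_mem _ (Ioo_subset_Icc_self hs), primitive_apply]

/-- A primitive along a curve is a solution of the associated integral equation. -/
theorem hasDerivAt_extendCurve [CompleteSpace E] {x y : C(Icc (-1 : ℝ) 1, E)} {p : E}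
    (h : x = ContinuousMap.const _ p + primitive y) {t : ℝ} (ht : t ∈ Ioo (-1 : ℝ) 1) :
    HasDerivAt (extendCurve x) (extendCurve y t) t := by
  refine ((extendCurve_primitive y ht).const_add p).congr_of_eventuallyEq ?_
  filter_upwards [isOpen_Ioo.mem_nhds ht] with s hs
  rw [extendCurve_of_mem _ (Ioo_subset_Icc_self hs), extendCurve_of_mem _ (Ioo_subset_Icc_self hs),
    h]
  rfl

theorem extendCurve_zero {x y : C(Icc (-1 : ℝ) 1, E)} {p : E}
    (h : x = ContinuousMap.const _ p + primitive y) : extendCurve x 0 = p := by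
  have h0 : (0 : ℝ) ∈ Icc (-1 : ℝ) 1 := by norm_num
  rw [extendCurve_of_mem _ h0, h]
  simp [primitive_apply]

end Primitive

/-! ### The local flow near an equilibrium -/

section LocalFlow

variable {E : Type*} [NormedAddCommGroup E] [NormedSpace ℝ E]

/-- Multiplication by a bump function; a global `C²` representative makes the superposition
operators defined on all curves. -/
theorem ContDiffAt.exists_contDiff_eventuallyEq {E F : Type*} [NormedAddCommGroup E]
    [NormedSpace ℝ E] [HasContDiffBump E] [NormedAddCommGroup F] [NormedSpace ℝ F]
    {f : E → F} {x : E} (hf : ContDiffAt ℝ 2 f x) :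
    ∃ g : E → F, ContDiff ℝ 2 g ∧ g =ᶠ[𝓝 x] f := by
  obtain ⟨r, hr, h⟩ := Metric.eventually_nhds_iff_ball.1 (hf.eventually (by simp))
  let χ : ContDiffBump x := ⟨r / 3, r / 2, by positivity, by linarith⟩
  refine ⟨fun y => χ y • f y, contDiff_iff_contDiffAt.2 fun y => ?_, ?_⟩
  · by_cases hy : y ∈ Metric.ball x r
    · exact χ.contDiff.contDiffAt.smul (h y hy)
    · have hy' : y ∉ tsupport χ := by
        rw [χ.tsupport_eq]
        intro hmem
        exact hy (Metric.closedBall_subset_ball (by change r / 2 < r; linarith) hmem)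
      have h0 : (fun y => χ y • f y) =ᶠ[𝓝 y] fun _ => 0 := by
        filter_upwards [notMem_tsupport_iff_eventuallyEq.1 hy'] with z hz
        simp [hz]
      exact contDiffAt_const.congr_of_eventuallyEq h0
  · filter_upwards [χ.eventuallyEq_one] with y hy
    simp [hy]

theorem hasFDerivAt_primitive_superposition {f : E → E} (hf : ContDiff ℝ 1 f)
    (x : C(Icc (-1 : ℝ) 1, E)) :
    HasFDerivAt (fun x => primitive (superposition _ hf.continuous x))
      (primitive.comp (pointwiseApply (superposition _ (hf.continuous_fderiv one_ne_zero) x))) x :=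
  HasFDerivAt.comp (g := fun y : C(Icc (-1 : ℝ) 1, E) => primitive y) x
    (ContinuousLinearMap.hasFDerivAt _) (hasFDerivAt_superposition hf x)

/-- Near an equilibrium at which the linearization is small, solutions on `[-1, 1]` form a `C²`
family of curves. -/
theorem exists_localFlow [CompleteSpace E] {f : E → E} (hf : ContDiff ℝ 2 f) (h0 : f 0 = 0)
    (hA : ‖fderiv ℝ f 0‖ < 1) :
    ∃ ψ : E → C(Icc (-1 : ℝ) 1, E), ContDiffAt ℝ 2 ψ 0 ∧ ψ 0 = 0 ∧
      ∀ᶠ p in 𝓝 0, ψ p = ContinuousMap.const _ p + primitive (superposition _ hf.continuous (ψ p)) := by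
  have hf1 : ContDiff ℝ 1 f := hf.of_le (by norm_num)
  -- A curve solves the integral equation from `p` exactly when `Θ` sends it to the constant curve
  -- `p`. The derivative of `Θ` at 0 is `1 - N`, invertible since integration over `[-1, 1]` from 0
  -- has norm at most 1 and hence `‖N‖ ≤ ‖Df(0)‖ < 1`.
  set Θ : C(Icc (-1 : ℝ) 1, E) → C(Icc (-1 : ℝ) 1, E) :=
    fun x => x - primitive (superposition _ hf.continuous x) with hΘ
  have hΘ2 : ContDiff ℝ 2 Θ :=
    contDiff_id.sub (primitive.contDiff.comp (contDiff_two_superposition hf))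
  set N : C(Icc (-1 : ℝ) 1, E) →L[ℝ] C(Icc (-1 : ℝ) 1, E) := primitive.comp
    (pointwiseApply (superposition _ (hf1.continuous_fderiv one_ne_zero) 0)) with hN
  have hΘ' : HasFDerivAt Θ (1 - N) 0 :=
    (hasFDerivAt_id _).sub (hasFDerivAt_primitive_superposition hf1 0)
  have hNlt : ‖N‖ < 1 := by
    refine lt_of_le_of_lt (ContinuousLinearMap.opNorm_le_bound _ (norm_nonneg _) fun x => ?_) hA
    refine (norm_primitive_apply_le _).trans ?_
    refine (ContinuousMap.norm_le _ (by positivity)).2 fun t => ?_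
    exact (ContinuousLinearMap.le_opNorm _ _).trans
      (mul_le_mul_of_nonneg_left (x.norm_coe_le_norm t) (norm_nonneg _))
  set e := ContinuousLinearEquiv.unitsEquiv ℝ _ (Units.oneSub N hNlt) with he
  have hΘe : HasFDerivAt Θ (e : C(Icc (-1 : ℝ) 1, E) →L[ℝ] C(Icc (-1 : ℝ) 1, E)) 0 := hΘ'
  have hΘ0 : Θ 0 = 0 := by
    have : superposition (Icc (-1 : ℝ) 1) hf.continuous 0 = 0 := by ext t; simp [h0]
    simp [hΘ, this]
  have hat := hΘ2.contDiffAt (x := 0)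
  set g := hat.localInverse hΘe two_ne_zero
  have hg : ContDiffAt ℝ 2 g 0 := by
    have := hat.to_localInverse hΘe two_ne_zero
    rwa [hΘ0] at this
  have hg0 : g 0 = 0 := by
    have := hat.localInverse_apply_image hΘe two_ne_zero
    rwa [hΘ0] at this
  have hgr : ∀ᶠ y in 𝓝 0, Θ (g y) = y := by
    have := (hat.hasStrictFDerivAt' hΘe two_ne_zero).eventually_right_inverse
    rwa [hΘ0] at this
  let c : E →L[ℝ] C(Icc (-1 : ℝ) 1, E) := ContinuousLinearMap.const ℝ _
  have hc0 : c 0 = 0 := map_zero c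
  refine ⟨fun p => g (c p), ?_, ?_, ?_⟩
  · exact ContDiffAt.comp 0 (by rwa [hc0]) c.contDiff.contDiffAt
  · simp only [hc0, hg0]
  · have hct : Tendsto c (𝓝 0) (𝓝 0) := by simpa [hc0] using c.continuous.tendsto 0
    filter_upwards [hct.eventually hgr] with p hp
    exact sub_eq_iff_eq_add.1 hp

/-- Group property of the flow, from uniqueness for the ODE. Both times are restricted to `[-1/2,
1/2]` so that their sum stays in the interval on which the curves are solutions. -/
theorem extendCurve_add_of_solution {f : E → E} (hf : Continuous f) [CompleteSpace E] {s : Set E}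
    {K : NNReal} (hK : LipschitzOnWith K f s) {x y : C(Icc (-1 : ℝ) 1, E)} {p : E} {t : ℝ}
    (ht : t ∈ Icc (-1 / 2 : ℝ) (1 / 2))
    (hx : x = ContinuousMap.const _ p + primitive (superposition _ hf x))
    (hy : y = ContinuousMap.const _ (extendCurve x t) + primitive (superposition _ hf y))
    (hxs : ∀ t, x t ∈ s) (hys : ∀ t, y t ∈ s) {u : ℝ} (hu : u ∈ Icc (-1 / 2 : ℝ) (1 / 2)) :
    extendCurve y u = extendCurve x (t + u) := by
  have hI : ∀ u ∈ Ioo (-1 / 2 : ℝ) (1 / 2), t + u ∈ Ioo (-1 : ℝ) 1 := fun u hu =>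
    ⟨by linarith [ht.1, hu.1], by linarith [ht.2, hu.2]⟩
  refine ODE_solution_unique_of_mem_Icc (v := fun _ => f) (s := fun _ => s) (K := K)
    (t₀ := 0) (a := -1 / 2) (b := 1 / 2) (fun _ _ => hK) (by norm_num)
    (continuous_extendCurve y).continuousOn ?_ (fun t _ => hys _)
    ((continuous_extendCurve x).comp (continuous_const.add continuous_id)).continuousOn ?_
    (fun t _ => hxs _) ?_ hu
  · exact fun u hu => hasDerivAt_extendCurve hy ⟨by linarith [hu.1], by linarith [hu.2]⟩
  · exact fun u hu => HasDerivAt.comp_const_add t u (hasDerivAt_extendCurve hx (hI u hu))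
  · simpa using extendCurve_zero hy

/-- Differentiating the integral equation in the initial point gives the variational equation `y' =
Df(0) y`. Its solutions have constant norm because `Df(0)` is skew. -/
theorem norm_fderiv_localFlow {E : Type*} [NormedAddCommGroup E] [InnerProductSpace ℝ E]
    [CompleteSpace E] {f : E → E} (hf : ContDiff ℝ 2 f)
    (hA : ∀ v, inner ℝ v (fderiv ℝ f 0 v) = 0) {ψ : E → C(Icc (-1 : ℝ) 1, E)}
    (hψ : ContDiffAt ℝ 2 ψ 0) (hψ0 : ψ 0 = 0)
    (hs : ∀ᶠ p in 𝓝 0, ψ p = ContinuousMap.const _ p +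
      primitive (superposition _ hf.continuous (ψ p)))
    (v : E) {t : ℝ} (ht : t ∈ Ioo (-1 : ℝ) 1) :
    ‖extendCurve (fderiv ℝ ψ 0 v) t‖ = ‖v‖ := by
  have hf1 : ContDiff ℝ 1 f := hf.of_le (by norm_num)
  let c : E →L[ℝ] C(Icc (-1 : ℝ) 1, E) := ContinuousLinearMap.const ℝ _
  have hψ' : HasFDerivAt ψ (fderiv ℝ ψ 0) 0 := (hψ.differentiableAt two_ne_zero).hasFDerivAt
  have h1 : HasFDerivAt (fun p => c p + primitive (superposition _ hf.continuous (ψ p))) _ 0 :=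
    c.hasFDerivAt.add ((hasFDerivAt_primitive_superposition hf1 (ψ 0)).comp (0 : E) hψ')
  have h2 := hψ'.unique (h1.congr_of_eventuallyEq hs)
  set y := fderiv ℝ ψ 0 v with hy
  have hyeq : y = ContinuousMap.const _ v + primitive (pointwiseApply
      (superposition _ (hf1.continuous_fderiv one_ne_zero) 0) y) := by
    conv_lhs => rw [hy, h2]
    rw [hψ0]
    rfl
  have hder : ∀ t ∈ Ioo (-1 : ℝ) 1, HasDerivAt (fun t => ‖extendCurve y t‖ ^ 2) 0 t := by
    intro t ht
    have h3 := (hasDerivAt_extendCurve hyeq ht).norm_sq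
    have h4 : inner ℝ (extendCurve y t) (extendCurve (pointwiseApply
      (superposition _ (hf1.continuous_fderiv one_ne_zero) 0) y) t) = 0 := hA _
    rwa [h4, mul_zero] at h3
  have h5 := isOpen_Ioo.is_const_of_deriv_eq_zero isPreconnected_Ioo
    (fun t ht => (hder t ht).differentiableAt.differentiableWithinAt)
    (fun t ht => (hder t ht).deriv) ht (show (0 : ℝ) ∈ Ioo (-1 : ℝ) 1 by norm_num)
  simp only [extendCurve_zero hyeq] at h5
  exact (pow_left_inj₀ (norm_nonneg _) (norm_nonneg _) two_ne_zero).1 h5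

end LocalFlow

/-! ### Integrating factors along curves -/

section IntegratingFactor

variable {E : Type*} [NormedAddCommGroup E]

/-- The integrating factor `exp (-∫₀ᵗ a)` along the curve `x`. -/
noncomputable def integratingFactor (a : E → ℝ) (x : C(Icc (-1 : ℝ) 1, E)) (t : ℝ) : ℝ :=
  Real.exp (-∫ s in (0 : ℝ)..t, a (extendCurve x s))

theorem integratingFactor_pos (a : E → ℝ) (x : C(Icc (-1 : ℝ) 1, E)) (t : ℝ) :
    0 < integratingFactor a x t := Real.exp_pos _

@[simp]
theorem integratingFactor_zero (a : E → ℝ) (x : C(Icc (-1 : ℝ) 1, E)) :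
    integratingFactor a x 0 = 1 := by simp [integratingFactor]

theorem hasDerivAt_integratingFactor {a : E → ℝ} (ha : Continuous a) (x : C(Icc (-1 : ℝ) 1, E))
    (t : ℝ) : HasDerivAt (integratingFactor a x)
      (-(a (extendCurve x t) * integratingFactor a x t)) t := by
  have hc : Continuous fun s => a (extendCurve x s) := ha.comp (continuous_extendCurve x)
  have h := (hc.integral_hasStrictDerivAt 0 t).hasDerivAt.neg.exp
  convert! h using 1
  simp only [integratingFactor]
  ring_nf
  rfl

theorem integratingFactor_add {a : E → ℝ} (ha : Continuous a) {x y : C(Icc (-1 : ℝ) 1, E)} {t s : ℝ}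
    (hxy : ∀ u ∈ uIcc 0 s, extendCurve y u = extendCurve x (t + u)) :
    integratingFactor a y s * integratingFactor a x t = integratingFactor a x (t + s) := by
  have hc : Continuous fun s => a (extendCurve x s) := ha.comp (continuous_extendCurve x)
  have h1 : ∫ u in (0 : ℝ)..s, a (extendCurve y u) = ∫ u in t..t + s, a (extendCurve x u) := by
    rw [intervalIntegral.integral_congr (g := fun u => a (extendCurve x (t + u)))
      (fun u hu => by simp only [hxy u hu]),
      intervalIntegral.integral_comp_add_left (fun u => a (extendCurve x u)), add_zero]
  simp only [integratingFactor]
  rw [h1, ← Real.exp_add, ← intervalIntegral.integral_add_adjacent_intervals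
    (hc.intervalIntegrable 0 t) (hc.intervalIntegrable t (t + s))]
  ring_nf

/-- The inhomogeneous contribution `∫₀ᵗ exp (-∫₀ˢ a) b ds` along the curve `x`. -/
noncomputable def forcingIntegral (a b : E → ℝ) (x : C(Icc (-1 : ℝ) 1, E)) (t : ℝ) : ℝ :=
  ∫ s in (0 : ℝ)..t, integratingFactor a x s * b (extendCurve x s)

theorem continuous_integratingFactor {a : E → ℝ} (ha : Continuous a)
    (x : C(Icc (-1 : ℝ) 1, E)) : Continuous (integratingFactor a x) :=
  continuous_iff_continuousAt.2 fun t => (hasDerivAt_integratingFactor ha x t).continuousAt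

theorem continuous_integratingFactor_mul {a b : E → ℝ} (ha : Continuous a) (hb : Continuous b)
    (x : C(Icc (-1 : ℝ) 1, E)) :
    Continuous fun s => integratingFactor a x s * b (extendCurve x s) :=
  (continuous_integratingFactor ha x).mul (hb.comp (continuous_extendCurve x))

theorem hasDerivAt_forcingIntegral {a b : E → ℝ} (ha : Continuous a) (hb : Continuous b)
    (x : C(Icc (-1 : ℝ) 1, E)) (t : ℝ) : HasDerivAt (forcingIntegral a b x)
      (integratingFactor a x t * b (extendCurve x t)) t :=
  ((continuous_integratingFactor_mul ha hb x).integral_hasStrictDerivAt 0 t).hasDerivAt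

theorem forcingIntegral_add {a b : E → ℝ} (ha : Continuous a) (hb : Continuous b)
    {x y : C(Icc (-1 : ℝ) 1, E)} {t s : ℝ}
    (hxy : ∀ u ∈ uIcc 0 s, extendCurve y u = extendCurve x (t + u)) :
    forcingIntegral a b y s * integratingFactor a x t + forcingIntegral a b x t =
      forcingIntegral a b x (t + s) := by
  have hc := continuous_integratingFactor_mul ha hb x
  have h1 : ∀ u ∈ uIcc 0 s, integratingFactor a y u * b (extendCurve y u) *
      integratingFactor a x t = integratingFactor a x (t + u) * b (extendCurve x (t + u)) := by
    intro u hu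
    rw [← integratingFactor_add ha fun w hw => hxy w (uIcc_subset_uIcc_left hu hw), hxy u hu]
    ring
  simp only [forcingIntegral]
  rw [← intervalIntegral.integral_mul_const, intervalIntegral.integral_congr h1,
    intervalIntegral.integral_comp_add_left
      (fun u => integratingFactor a x u * b (extendCurve x u)), add_zero, add_comm,
    intervalIntegral.integral_add_adjacent_intervals (hc.intervalIntegrable 0 t)
      (hc.intervalIntegrable t (t + s))]

/-- If `h` satisfies the variation of constants formula over backward time `τ` along a
trajectory, then the residual of its invariance equation is transported along the trajectory. -/
theorem residual_transport [NormedSpace ℝ E] {f : E → E} {a b h : E → ℝ} {h' : E → E →L[ℝ] ℝ}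
    (ha : Continuous a) (hb : Continuous b) {x : C(Icc (-1 : ℝ) 1, E)} {τ : ℝ}
    (hd0 : HasDerivAt (extendCurve x) (f (extendCurve x 0)) 0)
    (hdτ : HasDerivAt (extendCurve x) (f (extendCurve x τ)) τ)
    (hh0 : HasFDerivAt h (h' (extendCurve x 0)) (extendCurve x 0))
    (hhτ : HasFDerivAt h (h' (extendCurve x τ)) (extendCurve x τ))
    (hfun : ∀ᶠ t in 𝓝 0, integratingFactor a x t * h (extendCurve x t) - forcingIntegral a b x t =
      integratingFactor a x (t + τ) * h (extendCurve x (t + τ)) -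
        forcingIntegral a b x (t + τ)) :
    h' (extendCurve x 0) (f (extendCurve x 0)) -
        (a (extendCurve x 0) * h (extendCurve x 0) + b (extendCurve x 0)) =
      integratingFactor a x τ * (h' (extendCurve x τ) (f (extendCurve x τ)) -
        (a (extendCurve x τ) * h (extendCurve x τ) + b (extendCurve x τ))) := by
  -- The residual times the integrating factor is the time derivative of the expression in `hfun`,
  -- so differentiating that identity at `t = 0` gives the claim.
  have key : ∀ t, HasDerivAt (extendCurve x) (f (extendCurve x t)) t →
      HasFDerivAt h (h' (extendCurve x t)) (extendCurve x t) →
      HasDerivAt (fun t => integratingFactor a x t * h (extendCurve x t) -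
        forcingIntegral a b x t) (integratingFactor a x t * (h' (extendCurve x t)
        (f (extendCurve x t)) - (a (extendCurve x t) * h (extendCurve x t) +
        b (extendCurve x t)))) t := by
    intro t h1 h2
    have h3 := ((hasDerivAt_integratingFactor ha x t).mul (h2.comp_hasDerivAt t h1)).sub
      (hasDerivAt_forcingIntegral ha hb x t)
    convert! h3 using 1
    simp only [Function.comp]
    ring
  have e0 := key 0 hd0 hh0
  have eτ := key (0 + τ) (by simpa using hdτ) (by simpa using hhτ)
  have := e0.unique ((eτ.comp_add_const 0 τ).congr_of_eventuallyEq hfun)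
  simpa using this

end IntegratingFactor

/-! ### Smooth dependence of the integrating factor and forcing on the curve -/

section Regularity

variable {E : Type*} [NormedAddCommGroup E]

theorem integratingFactor_eq {a : E → ℝ} (ha : Continuous a) (x : C(Icc (-1 : ℝ) 1, E))
    (t : Icc (-1 : ℝ) 1) : integratingFactor a x t =
      superposition _ Real.continuous_exp (-(primitive (superposition _ ha x))) t := rfl

theorem forcingIntegral_eq {a b : E → ℝ} (ha : Continuous a) (hb : Continuous b)
    (x : C(Icc (-1 : ℝ) 1, E)) (t : Icc (-1 : ℝ) 1) :
    forcingIntegral a b x t = primitive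
      (superposition _ Real.continuous_exp (-(primitive (superposition _ ha x))) *
        superposition _ hb x) t := by
  rw [primitive_apply, forcingIntegral]
  refine intervalIntegral.integral_congr fun s hs => ?_
  have hs' : s ∈ Icc (-1 : ℝ) 1 :=
    (ordConnected_Icc.uIcc_subset (by norm_num) t.2) hs
  rw [extendCurve_of_mem _ hs', extendCurve_of_mem _ hs', integratingFactor_eq ha x ⟨s, hs'⟩]
  rfl

variable [NormedSpace ℝ E]

theorem contDiff_integratingFactor {a : E → ℝ} (ha : ContDiff ℝ 2 a) {t : ℝ}
    (ht : t ∈ Icc (-1 : ℝ) 1) :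
    ContDiff ℝ 2 fun x : C(Icc (-1 : ℝ) 1, E) => integratingFactor a x t := by
  have h1 : ContDiff ℝ 2 fun y : C(Icc (-1 : ℝ) 1, ℝ) => primitive y :=
    ContinuousLinearMap.contDiff _
  have h2 : ContDiff ℝ 2 fun y : C(Icc (-1 : ℝ) 1, ℝ) =>
      ContinuousMap.evalCLM ℝ (⟨t, ht⟩ : Icc (-1 : ℝ) 1) y := ContinuousLinearMap.contDiff _
  exact h2.comp ((contDiff_two_superposition Real.contDiff_exp).comp
    (h1.comp (contDiff_two_superposition ha)).neg)

theorem contDiff_forcingIntegral {a b : E → ℝ} (ha : ContDiff ℝ 2 a) (hb : ContDiff ℝ 2 b) {t : ℝ}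
    (ht : t ∈ Icc (-1 : ℝ) 1) :
    ContDiff ℝ 2 fun x : C(Icc (-1 : ℝ) 1, E) => forcingIntegral a b x t := by
  have h1 : ContDiff ℝ 2 fun y : C(Icc (-1 : ℝ) 1, ℝ) => primitive y :=
    ContinuousLinearMap.contDiff _
  have h2 : ContDiff ℝ 2 fun y : C(Icc (-1 : ℝ) 1, ℝ) =>
      ContinuousMap.evalCLM ℝ (⟨t, ht⟩ : Icc (-1 : ℝ) 1) y := ContinuousLinearMap.contDiff _
  have h3 := (contDiff_two_superposition (K := Icc (-1 : ℝ) 1) Real.contDiff_exp).comp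
    (h1.comp (contDiff_two_superposition ha)).neg
  convert! h2.comp (h1.comp (h3.mul (contDiff_two_superposition hb))) using 2 with x
  exact forcingIntegral_eq ha.continuous hb.continuous x ⟨t, ht⟩

end Regularity

/-! ### Invariant graphs of linear equations driven by a center -/

section InvariantGraph

variable {E : Type*} [NormedAddCommGroup E]

/-- A continuous function with a strict local minimum has arbitrarily small sublevel
neighbourhoods which cannot be left within a fixed larger ball. -/
theorem exists_pos_le_of_annulus [ProperSpace E] {H : E → ℝ} {R r : ℝ} (hr : 0 < r)
    (hc : ContinuousOn H (Metric.closedBall 0 R))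
    (hpos : ∀ p ∈ Metric.closedBall (0 : E) R, p ≠ 0 → 0 < H p) :
    ∃ c > 0, ∀ p ∈ Metric.closedBall (0 : E) R, H p < c → p ∈ Metric.ball (0 : E) r := by
  have hK : IsCompact (Metric.closedBall (0 : E) R \ Metric.ball 0 r) :=
    (isCompact_closedBall 0 R).diff Metric.isOpen_ball
  obtain ⟨c, hc0, h⟩ := hK.exists_forall_le' (hc.mono sdiff_subset) (a := 0) fun p hp =>
    hpos p hp.1 fun h0 => hp.2 (by simpa [h0] using hr)
  exact ⟨c, hc0, fun p hp hlt => by_contra fun hb => (h p ⟨hp, hb⟩).not_gt hlt⟩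

variable [InnerProductSpace ℝ E] [FiniteDimensional ℝ E]

/-- The backward variation of constants formula is solved as a fixed-point equation on a sublevel
set of `H`, which the flow preserves. The skew linearization keeps `Dφ` close to an isometry, so the
contraction by `T` dominates. -/
theorem exists_invariantGraph_of_contDiff {f : E → E} {a b H : E → ℝ} (hf : ContDiff ℝ 2 f)
    (ha : ContDiff ℝ 2 a) (hb : ContDiff ℝ 2 b) (hf0 : f 0 = 0) (hAlt : ‖fderiv ℝ f 0‖ < 1)
    (hA : ∀ v, inner ℝ v (fderiv ℝ f 0 v) = 0) (ha0 : a 0 < 0) (hb0 : b 0 = 0)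
    (hH0 : H 0 = 0) (hHpos : ∀ᶠ p in 𝓝 0, p ≠ 0 → 0 < H p)
    (hHd : ∀ᶠ p in 𝓝 0, ∃ H' : E →L[ℝ] ℝ, HasFDerivAt H H' p ∧ H' (f p) = 0)
    {N : Set E} (hN : N ∈ 𝓝 0) :
    ∃ (V : Set E) (h : E → ℝ), IsOpen V ∧ 0 ∈ V ∧ V ⊆ N ∧ ContDiffOn ℝ 2 h V ∧ h 0 = 0 ∧
      ∀ p ∈ V, fderiv ℝ h p (f p) = a p * h p + b p := by
  have hproper : ProperSpace E := FiniteDimensional.proper ℝ E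
  have hcomplete : CompleteSpace E := FiniteDimensional.complete ℝ E
  obtain ⟨ψ, hψ, hψ0, hsol⟩ := exists_localFlow hf hf0 hAlt
  -- Negative time makes the factor at the origin `exp(a(0)/2) < 1`. Length `1/2` leaves room for
  -- time shifts inside `[-1, 1]`.
  set τ : ℝ := -1 / 2 with hτ
  have hτI : τ ∈ Icc (-1 : ℝ) 1 := by norm_num [hτ]
  set φ : E → E := fun p => extendCurve (ψ p) τ with hφdef
  set T : E → ℝ →L[ℝ] ℝ := fun p => integratingFactor a (ψ p) τ • ContinuousLinearMap.id ℝ ℝ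
    with hTdef
  set B : E → ℝ := fun p => -forcingIntegral a b (ψ p) τ with hBdef
  have hψ' : HasFDerivAt ψ (fderiv ℝ ψ 0) 0 := (hψ.differentiableAt two_ne_zero).hasFDerivAt
  set ev : C(Icc (-1 : ℝ) 1, E) →L[ℝ] E := ContinuousMap.evalCLM ℝ (⟨τ, hτI⟩ : Icc (-1 : ℝ) 1)
  have hφev : φ = fun p => ev (ψ p) := funext fun p => extendCurve_of_mem _ hτI
  have hφ2 : ContDiffAt ℝ 2 φ 0 := by
    rw [hφev]
    exact ev.contDiff.contDiffAt.comp 0 hψ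
  have hφ0' : ‖fderiv ℝ φ 0‖ ≤ 1 := by
    have : HasFDerivAt φ (ev.comp (fderiv ℝ ψ 0)) 0 := by
      rw [hφev]
      exact ev.hasFDerivAt.comp 0 hψ'
    rw [this.fderiv]
    refine ContinuousLinearMap.opNorm_le_bound _ zero_le_one fun v => ?_
    rw [one_mul, ← norm_fderiv_localFlow hf hA hψ hψ0 hsol v (t := τ) (by norm_num [hτ]),
      extendCurve_of_mem _ hτI]
    rfl
  have hφ0 : φ 0 = 0 := by
    simp only [hφdef, hψ0]
    rfl
  have hT2 : ContDiffAt ℝ 2 T 0 :=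
    ((contDiff_integratingFactor ha hτI).contDiffAt.comp 0 hψ).smul contDiffAt_const
  have hB2 : ContDiffAt ℝ 2 B 0 :=
    ((contDiff_forcingIntegral ha hb hτI).contDiffAt.comp 0 hψ).neg
  have hTnorm : ∀ p, ‖T p‖ = integratingFactor a (ψ p) τ := fun p => by
    rw [hTdef]
    simp [norm_smul, abs_of_pos (integratingFactor_pos a (ψ p) τ)]
  have hcurve0 : ∀ s, extendCurve (0 : C(Icc (-1 : ℝ) 1, E)) s = 0 := fun s => rfl
  have hT0 : ‖T 0‖ < 1 := by
    rw [hTnorm, hψ0, integratingFactor]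
    simp only [hcurve0, intervalIntegral.integral_const, hτ, smul_eq_mul]
    rw [Real.exp_lt_one_iff]
    linarith
  have hB0 : B 0 = 0 := by
    simp [hBdef, hψ0, forcingIntegral, hcurve0, hb0]
  obtain ⟨q, hTq, hq1⟩ := exists_between hT0
  have hq0 : 0 ≤ q := (norm_nonneg _).trans hTq.le
  obtain ⟨m, hm1, hqm, hqmm⟩ : ∃ m : ℝ, 1 < m ∧ q * m < 1 ∧ q * m * m < 1 :=
    ⟨1 + (1 - q) / 4, by linarith, by nlinarith, by nlinarith [mul_nonneg hq0 (sub_nonneg.2 hq1.le)]⟩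
  obtain ⟨rφ, hrφ, hφb, hφb'⟩ := hφ2.eventually_bddC1On
  obtain ⟨rT, hrT, hTb, hTb'⟩ := hT2.eventually_bddC1On
  obtain ⟨rB, hrB, hBb, hBb'⟩ := hB2.eventually_bddC1On
  obtain ⟨K, s, hs, hlip⟩ := (hf.of_le one_le_two).contDiffAt (x := (0 : E)).exists_lipschitzOnWith
  have e1 : ∀ᶠ p in 𝓝 0, ‖fderiv ℝ φ p‖ < m :=
    (ContinuousAt.norm (E := E →L[ℝ] E)
      (hφ2.fderiv_right (m := 0) (by norm_num)).continuousAt).eventually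
      (gt_mem_nhds (hφ0'.trans_lt hm1))
  have e2 : ∀ᶠ p in 𝓝 0, ‖T p‖ < q :=
    (ContinuousAt.norm (E := ℝ →L[ℝ] ℝ) hT2.continuousAt).eventually (gt_mem_nhds hTq)
  have e3 : ∀ᶠ p in 𝓝 0, ‖f p‖ < ‖f 0‖ + 1 :=
    hf.continuous.norm.continuousAt.eventually (gt_mem_nhds (lt_add_one _))
  have e4 : ∀ᶠ p in 𝓝 0, ‖a p‖ < ‖a 0‖ + 1 :=
    ha.continuous.norm.continuousAt.eventually (gt_mem_nhds (lt_add_one _))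
  have e5 : ∀ᶠ p in 𝓝 0, ‖b p‖ < ‖b 0‖ + 1 :=
    hb.continuous.norm.continuousAt.eventually (gt_mem_nhds (lt_add_one _))
  obtain ⟨R, hR, hball⟩ := Metric.eventually_nhds_iff_ball.1 (e1.and (e2.and (e3.and (e4.and
    (e5.and (hsol.and (hHpos.and (hHd.and ((eventually_mem_set.2 hs).and
    ((eventually_mem_set.2 hN).and ((eventually_mem_set.2 (Metric.ball_mem_nhds 0 hrφ)).and
    ((eventually_mem_set.2 (Metric.ball_mem_nhds 0 hrT)).and
    (eventually_mem_set.2 (Metric.ball_mem_nhds 0 hrB))))))))))))))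
  simp only [imp_and, forall_and] at hball
  obtain ⟨bφ', bT, bf, ba, bb, bsol, bHpos, bHd, bs, bN, bφ, bTr, bB⟩ := hball
  have hψt : ∀ᶠ p in 𝓝 0, ‖ψ p‖ < R / 2 := by
    refine (ContinuousAt.norm (E := C(Icc (-1 : ℝ) 1, E)) hψ.continuousAt).eventually
      (gt_mem_nhds ?_)
    simp only [hψ0, norm_zero]
    positivity
  obtain ⟨r, hr, hψr⟩ := Metric.eventually_nhds_iff_ball.1
    (hψt.and (eventually_mem_set.2 (Metric.ball_mem_nhds (0 : E) (half_pos hR))))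
  have hsub : Metric.closedBall (0 : E) (R / 2) ⊆ Metric.ball 0 R :=
    Metric.closedBall_subset_ball (by linarith)
  have hHc : ContinuousOn H (Metric.ball 0 R) := fun p hp => by
    obtain ⟨_, hd, _⟩ := (bHd p hp)
    exact hd.continuousAt.continuousWithinAt
  -- Curves issued from the `r`-ball stay in the closed `R/2`-ball, where `H < c` forces a return to
  -- the `r`-ball. Since `H` is constant along them, `V` below is carried into itself in both time
  -- directions.
  obtain ⟨c, hc0, hc⟩ := exists_pos_le_of_annulus hr (hHc.mono hsub)
    fun p hp => (bHpos p (hsub hp))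
  set V : Set E := Metric.ball 0 r ∩ H ⁻¹' Iio c with hV
  have hrR : Metric.ball (0 : E) r ⊆ Metric.ball 0 R := fun p hp =>
    Metric.ball_subset_ball (by linarith) (hψr p hp).2
  have hVR : V ⊆ Metric.ball 0 R := inter_subset_left.trans hrR
  have hVo : IsOpen V := (hHc.mono hrR).isOpen_inter_preimage Metric.isOpen_ball isOpen_Iio
  have h0V : (0 : E) ∈ V := ⟨Metric.mem_ball_self hr, by simpa [hH0] using hc0⟩
  have hsolV : ∀ p ∈ V, ψ p = ContinuousMap.const _ p +
      primitive (superposition _ hf.continuous (ψ p)) := fun p hp =>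
    (bsol p (hVR hp))
  have hval : ∀ p ∈ V, ∀ t, extendCurve (ψ p) t ∈ Metric.closedBall (0 : E) (R / 2) :=
    fun p hp t => mem_closedBall_zero_iff.2
      ((norm_extendCurve_le _ _).trans (hψr p hp.1).1.le)
  have hder : ∀ p ∈ V, ∀ t ∈ Ioo (-1 : ℝ) 1,
      HasDerivAt (extendCurve (ψ p)) (f (extendCurve (ψ p) t)) t :=
    fun p hp t ht => hasDerivAt_extendCurve (hsolV p hp) ht
  have hstart : ∀ p ∈ V, extendCurve (ψ p) 0 = p := fun p hp => extendCurve_zero (hsolV p hp)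
  have horbit : ∀ p ∈ V, ∀ t ∈ Ioo (-1 : ℝ) 1, extendCurve (ψ p) t ∈ V := by
    intro p hp t ht
    have hd : ∀ t ∈ Ioo (-1 : ℝ) 1, HasDerivAt (fun t => H (extendCurve (ψ p) t)) 0 t := by
      intro t ht
      obtain ⟨H', hH', hHf⟩ := (bHd _ (hsub (hval p hp t)))
      have := hH'.comp_hasDerivAt t (hder p hp t ht)
      rwa [hHf] at this
    have hconst := isOpen_Ioo.is_const_of_deriv_eq_zero isPreconnected_Ioo
      (fun t ht => (hd t ht).differentiableAt.differentiableWithinAt)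
      (fun t ht => (hd t ht).deriv) ht (show (0 : ℝ) ∈ Ioo (-1 : ℝ) 1 by norm_num)
    have hlt : H (extendCurve (ψ p) t) < c := by
      simp only [hstart p hp] at hconst
      rw [hconst]
      exact hp.2
    exact ⟨hc _ (hval p hp t) hlt, hlt⟩
  have hmaps : MapsTo φ V V := fun p hp => horbit p hp τ (by norm_num [hτ])
  have hsubφ : V ⊆ Metric.ball 0 rφ := fun p hp => (bφ p (hVR hp))
  have hsubT : V ⊆ Metric.ball 0 rT := fun p hp => (bTr p (hVR hp))
  have hsubB : V ⊆ Metric.ball 0 rB := fun p hp => (bB p (hVR hp))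
  have hTqV : ∀ p ∈ V, ‖T p‖ ≤ q := fun p hp => (bT p (hVR hp)).le
  obtain ⟨h, hh2, hhb, hfix⟩ := exists_contDiffOn_two_fixedPoint hVo (hφb.mono hsubφ)
    (hφb'.mono hsubφ) hmaps hq0 (zero_le_one.trans hm1.le)
    (fun p hp => (bφ' p (hVR hp)).le) (hTb.mono hsubT) (hTb'.mono hsubT) hTqV hq1 hqm hqmm
    (hBb.mono hsubB) (hBb'.mono hsubB)
  have hfix' : ∀ p ∈ V, h p = -forcingIntegral a b (ψ p) τ +
      integratingFactor a (ψ p) τ * h (φ p) := fun p hp => hfix p hp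
  refine ⟨V, h, hVo, h0V, fun p hp => (bN p (hVR hp)), hh2, ?_, ?_⟩
  -- At the fixed point 0 of `φ` the equation reads `h 0 = T 0 (h 0)` with `‖T 0‖ < 1`.
  · have h1 := hfix 0 h0V
    rw [hB0, zero_add, hφ0] at h1
    have h2 : ‖h 0‖ ≤ ‖T 0‖ * ‖h 0‖ := by
      conv_lhs => rw [h1]
      exact (T 0).le_opNorm _
    exact norm_le_zero_iff.1 (by nlinarith [norm_nonneg (h 0)])
  -- The formula only relates `h` at times `0` and `τ`. The infinitesimal invariance equation
  -- follows because its residual `ρ` is a bounded solution of `ρ = T · (ρ ∘ φ)`.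
  set ρ : E → ℝ := fun p => fderiv ℝ h p (f p) - (a p * h p + b p) with hρ
  have hρfix : ∀ p ∈ V, ρ p = (fun _ => (0 : ℝ)) p + T p (ρ (φ p)) := by
    intro p hp
    have hτ0 : (0 : ℝ) ∈ Ioo (-1 : ℝ) 1 := by norm_num
    have hττ : τ ∈ Ioo (-1 : ℝ) 1 := by norm_num [hτ]
    have hres := residual_transport (f := f) (h := h) (h' := fderiv ℝ h) (τ := τ) ha.continuous
      hb.continuous (hder p hp 0 hτ0) (hder p hp τ hττ)
      (hhb.hasFDerivAt hVo (horbit p hp 0 hτ0)) (hhb.hasFDerivAt hVo (horbit p hp τ hττ)) (by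
        filter_upwards [Icc_mem_nhds (show (-1 / 2 : ℝ) < 0 by norm_num)
          (show (0 : ℝ) < 1 / 2 by norm_num)] with t ht
        have htI : t ∈ Ioo (-1 : ℝ) 1 := ⟨by linarith [ht.1], by linarith [ht.2]⟩
        have hXt := horbit p hp t htI
        have hshift : ∀ u ∈ uIcc 0 τ,
            extendCurve (ψ (extendCurve (ψ p) t)) u = extendCurve (ψ p) (t + u) := by
          intro u hu
          rw [uIcc_of_ge (by norm_num [hτ])] at hu
          refine extendCurve_add_of_solution hf.continuous (s := s) hlip ht (hsolV p hp)
            (hsolV _ hXt) (fun t => ?_) (fun t => ?_) ⟨hu.1, by linarith [hu.2]⟩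
          · rw [← extendCurve_of_mem (ψ p) t.2]
            exact (bs _ (hsub (hval p hp t)))
          · rw [← extendCurve_of_mem (ψ (extendCurve (ψ p) ↑_)) t.2]
            exact (bs _ (hsub (hval _ hXt t)))
        -- The fixed-point equation at the shifted point `x(t)`, rewritten by the cocycle
        -- identities, is the identity required by the transport lemma.
        have h1 := hfix' _ hXt
        have h2 : φ (extendCurve (ψ p) t) = extendCurve (ψ p) (t + τ) :=
          hshift τ right_mem_uIcc
        rw [h2] at h1
        rw [← forcingIntegral_add ha.continuous hb.continuous hshift,
          ← integratingFactor_add ha.continuous hshift, h1]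
        ring)
    rw [hstart p hp] at hres
    rw [zero_add]
    exact hres
  obtain ⟨C, hC, hCb⟩ := hhb.bounded
  have hzero : EqOn ρ (fun _ => 0) V := by
    refine eqOn_of_bounded_fixedPoint hmaps hq0 hq1 hTqV hρfix (fun p hp => by simp)
      (C := C * (‖f 0‖ + 1) + ((‖a 0‖ + 1) * C + (‖b 0‖ + 1))) fun p hp => ?_
    rw [sub_zero]
    refine (norm_sub_le _ _).trans (add_le_add ?_ ((norm_add_le _ _).trans (add_le_add ?_ ?_)))
    · refine ((fderiv ℝ h p).le_opNorm _).trans ?_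
      gcongr
      exacts [(hCb p hp).2, (bf p (hVR hp)).le]
    · rw [norm_mul]
      gcongr
      exacts [(ba p (hVR hp)).le, (hCb p hp).1]
    · exact (bb p (hVR hp)).le
  exact fun p hp => sub_eq_zero.1 (hzero hp)

/-- A scalar linear equation `y' = a(p) y + b(p)` with `a(0) < 0`, driven by a `C²` planar
(or higher dimensional) field `f` with skew linearization and a conserved quantity with a strict
minimum at the equilibrium `0`, has a `C²` invariant graph through `0`. -/
theorem exists_invariantGraph {f : E → E} {a b H : E → ℝ} (hf : ContDiffAt ℝ 2 f 0)
    (ha : ContDiffAt ℝ 2 a 0) (hb : ContDiffAt ℝ 2 b 0) (hf0 : f 0 = 0)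
    (hA : ∀ v, inner ℝ v (fderiv ℝ f 0 v) = 0) (ha0 : a 0 < 0) (hb0 : b 0 = 0)
    (hH0 : H 0 = 0) (hHpos : ∀ᶠ p in 𝓝 0, p ≠ 0 → 0 < H p)
    (hHd : ∀ᶠ p in 𝓝 0, ∃ H' : E →L[ℝ] ℝ, HasFDerivAt H H' p ∧ H' (f p) = 0)
    {N : Set E} (hN : N ∈ 𝓝 0) :
    ∃ (V : Set E) (h : E → ℝ), IsOpen V ∧ 0 ∈ V ∧ V ⊆ N ∧ ContDiffOn ℝ 2 h V ∧ h 0 = 0 ∧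
      ∀ p ∈ V, fderiv ℝ h p (f p) = a p * h p + b p := by
  obtain ⟨f₁, hf₁, hff⟩ := hf.exists_contDiff_eventuallyEq
  obtain ⟨a₁, ha₁, haa⟩ := ha.exists_contDiff_eventuallyEq
  obtain ⟨b₁, hb₁, hbb⟩ := hb.exists_contDiff_eventuallyEq
  -- Slowing time by `ε` brings the linearization below norm 1. The invariance equation is
  -- homogeneous in `(f, a, b)`, so `h` is unaffected.
  set ε : ℝ := (‖fderiv ℝ f 0‖ + 1)⁻¹ with hε
  have hε0 : 0 < ε := by positivity
  have hd : fderiv ℝ (fun p => ε • f₁ p) 0 = ε • fderiv ℝ f 0 := by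
    rw [fderiv_fun_const_smul (hf₁.differentiable two_ne_zero 0), hff.fderiv_eq]
  obtain ⟨V, h, hV, h0, hVN, hh, hh0, hinv⟩ := exists_invariantGraph_of_contDiff
    (f := fun p => ε • f₁ p) (a := fun p => ε * a₁ p) (b := fun p => ε * b₁ p) (H := H)
    (hf₁.const_smul ε) (contDiff_const.mul ha₁) (contDiff_const.mul hb₁)
    (by rw [hff.self_of_nhds, hf0, smul_zero])
    (by
      rw [hd, norm_smul, Real.norm_of_nonneg hε0.le, hε, inv_mul_lt_iff₀ (by positivity)]
      linarith)
    (fun v => by rw [hd, smul_apply, inner_smul_right, hA, mul_zero])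
    (by rw [haa.self_of_nhds]; exact mul_neg_of_pos_of_neg hε0 ha0)
    (by rw [hbb.self_of_nhds, hb0, mul_zero]) hH0 hHpos
    (by
      filter_upwards [hHd, hff] with p hp hfp
      obtain ⟨H', h1, h2⟩ := hp
      exact ⟨H', h1, by rw [hfp, map_smul, h2, smul_zero]⟩)
    (inter_mem hN (hff.and (haa.and hbb)))
  refine ⟨V, h, hV, h0, fun p hp => (hVN hp).1, hh, hh0, fun p hp => ?_⟩
  obtain ⟨h1, h2, h3⟩ := (hVN hp).2
  have := hinv p hp
  rw [h1, h2, h3, map_smul, smul_eq_mul, mul_assoc, ← mul_add] at this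
  exact mul_left_cancel₀ hε0.ne' this

end InvariantGraph

/-! ### The center subspace -/

/-- If `ℓ` is a left eigenvector of `A` for an eigenvalue with nonzero real part and `A² = -Ω²` on
the kernel of `ℓ`, then this kernel is the center subspace. -/
theorem centerSubspace_eq_ker {E : Type*} [NormedAddCommGroup E] [NormedSpace ℝ E]
    {A : E →ₗ[ℝ] E} {ℓ : E →ₗ[ℝ] ℝ} {γ Ω : ℝ} (hγ : γ ≠ 0) (hΩ : Ω ≠ 0)
    (hℓ : ∀ v, ℓ (A v) = γ * ℓ v) (hA : ∀ v, ℓ v = 0 → A (A v) = -(Ω ^ 2 • v)) :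
    centerSubspace A = LinearMap.ker ℓ := by
  set L : ℂ ⊗[ℝ] E →ₗ[ℂ] ℂ :=
    (TensorProduct.AlgebraTensorModule.rid ℝ ℂ ℂ).toLinearMap.comp (ℓ.baseChange ℂ) with hL
  have hLt : ∀ (z : ℂ) v, L (z ⊗ₜ v) = ℓ v • z := fun z v => by simp [hL]
  have hLA : ∀ x, L (A.baseChange ℂ x) = γ * L x := by
    intro x
    induction x with
    | zero => simp
    | tmul z v => simp [hLt, hℓ, mul_assoc]
    | add x y hx hy => simp [hx, hy, mul_add]
  -- On a generalized eigenvector for `μ` this gives `(γ - μ)^k L x = 0`, and `γ ≠ μ` when `μ` is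
  -- imaginary, so `L x = 0`.
  have hpow : ∀ (μ : ℂ) (k : ℕ) x,
      L (((A.baseChange ℂ - μ • (1 : Module.End ℂ (ℂ ⊗[ℝ] E))) ^ k) x) = (γ - μ) ^ k * L x := by
    intro μ k
    induction k with
    | zero => simp
    | succ k ih =>
      intro x
      rw [pow_succ, Module.End.mul_apply, ih, LinearMap.sub_apply, map_sub, hLA]
      simp
      ring
  have hle : (⨆ μ : {μ : ℂ // μ.re = 0},
      Module.End.maxGenEigenspace (A.baseChange ℂ) (μ : ℂ)) ≤ LinearMap.ker L := by
    refine iSup_le fun μ x hx => ?_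
    obtain ⟨k, hk⟩ := (Module.End.mem_maxGenEigenspace _ _ _).1 hx
    have h1 := hpow μ k x
    rw [hk, map_zero] at h1
    have h2 : (γ - μ : ℂ) ≠ 0 := by
      intro h
      have := congrArg Complex.re h
      simp [μ.2] at this
      exact hγ this
    exact (mul_eq_zero.1 h1.symm).resolve_left (pow_ne_zero _ h2)
  ext v
  constructor
  · intro hv
    have h1 : L (1 ⊗ₜ v) = 0 := hle hv
    simpa [hLt] using h1
  · intro hv
    have hAv := hA v hv
    set S := ⨆ μ : {μ : ℂ // μ.re = 0}, Module.End.maxGenEigenspace (A.baseChange ℂ) (μ : ℂ)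
      with hS
    -- For `μ = ±iΩ` the vector `Av + μv` is annihilated by `A - μ`; the difference of the two is
    -- `2iΩ v`.
    have hmem : ∀ μ : ℂ, μ.re = 0 → μ ^ 2 = -(Ω ^ 2 : ℂ) →
        (1 : ℂ) ⊗ₜ[ℝ] A v + μ • ((1 : ℂ) ⊗ₜ[ℝ] v) ∈ S := by
      intro μ hμ hμ2
      refine Submodule.mem_iSup_of_mem (⟨μ, hμ⟩ : {μ : ℂ // μ.re = 0}) ?_
      refine (Module.End.mem_maxGenEigenspace _ _ _).2 ⟨1, ?_⟩
      have e1 : (1 : ℂ) ⊗ₜ[ℝ] A (A v) = μ • μ • ((1 : ℂ) ⊗ₜ[ℝ] v) := by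
        rw [hAv, smul_smul, ← sq, hμ2, TensorProduct.tmul_neg, TensorProduct.tmul_smul, neg_smul,
          ← Complex.ofReal_pow]
        rfl
      rw [pow_one, LinearMap.sub_apply, map_add, map_smul, LinearMap.baseChange_tmul,
        LinearMap.baseChange_tmul, e1, LinearMap.smul_apply, Module.End.one_apply, add_comm]
      exact sub_eq_zero.2 (smul_add μ _ _).symm
    have hi := S.sub_mem (hmem (Ω * Complex.I) (by simp) (by rw [mul_pow, Complex.I_sq]; ring))
      (hmem (-(Ω * Complex.I)) (by simp) (by rw [neg_sq, mul_pow, Complex.I_sq]; ring))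
    have h2 : (1 : ℂ) ⊗ₜ[ℝ] v = (2 * (Ω * Complex.I))⁻¹ •
        ((1 : ℂ) ⊗ₜ[ℝ] A v + (Ω * Complex.I) • ((1 : ℂ) ⊗ₜ[ℝ] v) -
          ((1 : ℂ) ⊗ₜ[ℝ] A v + (-(Ω * Complex.I)) • ((1 : ℂ) ⊗ₜ[ℝ] v))) := by
      have hne : (2 * (Ω * Complex.I) : ℂ) ≠ 0 := by simp [hΩ]
      rw [add_sub_add_left_eq_sub, ← sub_smul, smul_smul, sub_neg_eq_add, ← two_mul,
        inv_mul_cancel₀ hne, one_smul]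
    have h3 := S.smul_mem (2 * (Ω * Complex.I))⁻¹ hi
    rw [← h2] at h3
    exact h3

/-! ### Skew products with a linear fibre equation -/

section SkewProduct

variable {X : Type*} [NormedAddCommGroup X] [NormedSpace ℝ X]

theorem hasFDerivAt_skewProduct {f : X → X} {a b : X → ℝ} {A : X →L[ℝ] X} {b' : X →L[ℝ] ℝ}
    (hf : HasFDerivAt f A 0) (ha : DifferentiableAt ℝ a 0) (hb : HasFDerivAt b b' 0) :
    HasFDerivAt (fun x : X × ℝ => (f x.1, a x.1 * x.2 + b x.1))
      ((A.comp (ContinuousLinearMap.fst ℝ X ℝ)).prod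
        (a 0 • ContinuousLinearMap.snd ℝ X ℝ + b'.comp (ContinuousLinearMap.fst ℝ X ℝ))) 0 := by
  have h1 : HasFDerivAt (Prod.fst : X × ℝ → X) (ContinuousLinearMap.fst ℝ X ℝ) 0 := hasFDerivAt_fst
  have h2 : HasFDerivAt (Prod.snd : X × ℝ → ℝ) (ContinuousLinearMap.snd ℝ X ℝ) 0 := hasFDerivAt_snd
  have h3 := (ha.hasFDerivAt.comp (0 : X × ℝ) h1).mul h2
  convert! (hf.comp (0 : X × ℝ) h1).prodMk (h3.add (hb.comp (0 : X × ℝ) h1)) using 1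
  ext <;> simp

/-- Linearization of the invariance equation `Dh(p) f(p) = a(p) h(p) + b(p)` at the equilibrium. -/
theorem fderiv_invariantGraph {f : X → X} {a b h : X → ℝ} {A : X →L[ℝ] X} {b' : X →L[ℝ] ℝ}
    (hf : HasFDerivAt f A 0) (hf0 : f 0 = 0) (ha : DifferentiableAt ℝ a 0)
    (hb : HasFDerivAt b b' 0) (hh : ContDiffAt ℝ 2 h 0) (hh0 : h 0 = 0)
    (hinv : ∀ᶠ p in 𝓝 0, fderiv ℝ h p (f p) = a p * h p + b p) (v : X) :
    fderiv ℝ h 0 (A v) = a 0 * fderiv ℝ h 0 v + b' v := by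
  have h1 : HasFDerivAt (fderiv ℝ h) (fderiv ℝ (fderiv ℝ h) 0) 0 :=
    ((hh.fderiv_right (m := 1) (by norm_num [one_add_one_eq_two])).differentiableAt
      one_ne_zero).hasFDerivAt
  have h2 := h1.clm_apply hf
  have h3 := (ha.hasFDerivAt.mul (hh.differentiableAt two_ne_zero).hasFDerivAt).add hb
  have h4 := h2.unique (h3.congr_of_eventuallyEq hinv)
  have h5 := DFunLike.congr_fun h4 v
  simpa [hf0, hh0] using h5

/-- A graph solving the invariance equation is locally invariant. -/
theorem mem_graphOver_of_invariantGraph {f : X → X} {a b h : X → ℝ} {V : Set X} {C : NNReal}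
    (hV : IsOpen V) (hh : DifferentiableOn ℝ h V) (ha : ∀ p ∈ V, ‖a p‖₊ ≤ C)
    (hinv : ∀ p ∈ V, fderiv ℝ h p (f p) = a p * h p + b p) {s t : ℝ} {x : ℝ → X × ℝ}
    (hx : ∀ u ∈ Ioo s t, HasDerivAt x (f (x u).1, a (x u).1 * (x u).2 + b (x u).1) u)
    (hxV : ∀ u ∈ Ioo s t, (x u).1 ∈ V) {t₀ : ℝ} (ht₀ : t₀ ∈ Ioo s t)
    (hmem : x t₀ ∈ graphOver V h) : ∀ u ∈ Ioo s t, x u ∈ graphOver V h := by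
  -- The height above the graph solves a homogeneous linear equation with bounded coefficient, so it
  -- vanishes throughout once it vanishes at `t₀`.
  have h1 : ∀ u ∈ Ioo s t, HasDerivAt (fun u => (x u).2 - h (x u).1)
      (a (x u).1 * ((x u).2 - h (x u).1)) u := by
    intro u hu
    have hd : HasFDerivAt h (fderiv ℝ h (x u).1) (x u).1 :=
      ((hh _ (hxV u hu)).differentiableAt (hV.mem_nhds (hxV u hu))).hasFDerivAt
    have e1 : HasDerivAt (fun u => (x u).1) (f (x u).1) u := (hx u hu).fst
    have e2 : HasDerivAt (fun u => (x u).2) (a (x u).1 * (x u).2 + b (x u).1) u := (hx u hu).snd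
    convert! e2.sub (hd.comp_hasDerivAt u e1) using 1
    rw [hinv _ (hxV u hu)]
    ring
  have h2 := ODE_solution_unique_of_mem_Ioo (v := fun u y => a (x u).1 * y) (s := fun _ => univ)
    (K := C) (f := fun u => (x u).2 - h (x u).1) (g := fun _ => 0)
    (fun u hu => (LipschitzWith.of_dist_le_mul fun y z => by
      rw [dist_eq_norm, dist_eq_norm, ← mul_sub, norm_mul]
      exact mul_le_mul_of_nonneg_right (ha _ (hxV u hu)) (norm_nonneg _)).lipschitzOnWith)
    ht₀ (fun u hu => ⟨h1 u hu, mem_univ _⟩)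
    (fun u _ => ⟨by simpa using hasDerivAt_const u (0 : ℝ), mem_univ _⟩)
    (by simp only [hmem.2, sub_self])
  exact fun u hu => ⟨hxV u hu, sub_eq_zero.1 (h2 hu)⟩

/-- `exists_invariantGraph` in coordinates in which the linearization is only conjugate to a skew
operator. -/
theorem exists_invariantGraph_of_equiv {E : Type*} [NormedAddCommGroup E] [InnerProductSpace ℝ E]
    [FiniteDimensional ℝ E] (e : E ≃L[ℝ] X) {f : X → X} {a b H : X → ℝ}
    (hf : ContDiffAt ℝ 2 f 0) (ha : ContDiffAt ℝ 2 a 0) (hb : ContDiffAt ℝ 2 b 0) (hf0 : f 0 = 0)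
    {A : X →L[ℝ] X} (hfA : HasFDerivAt f A 0) (hA : ∀ v, inner ℝ v (e.symm (A (e v))) = 0)
    (ha0 : a 0 < 0) (hb0 : b 0 = 0) (hH0 : H 0 = 0) (hHpos : ∀ᶠ p in 𝓝 0, p ≠ 0 → 0 < H p)
    (hHd : ∀ᶠ p in 𝓝 0, ∃ H' : X →L[ℝ] ℝ, HasFDerivAt H H' p ∧ H' (f p) = 0)
    {N : Set X} (hN : N ∈ 𝓝 0) :
    ∃ (V : Set X) (h : X → ℝ), IsOpen V ∧ 0 ∈ V ∧ V ⊆ N ∧ ContDiffOn ℝ 2 h V ∧ h 0 = 0 ∧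
      ∀ p ∈ V, fderiv ℝ h p (f p) = a p * h p + b p := by
  have het : Tendsto e (𝓝 0) (𝓝 0) := by simpa using e.continuous.tendsto 0
  have he0 : e 0 = 0 := map_zero e
  have hcd : ∀ {G : Type} [NormedAddCommGroup G] [NormedSpace ℝ G] {g : X → G},
      ContDiffAt ℝ 2 g 0 → ContDiffAt ℝ 2 (fun z => g (e z)) 0 := fun {G} _ _ {g} hg =>
    ContDiffAt.comp 0 (by rwa [he0]) e.contDiff.contDiffAt
  have hfe : HasFDerivAt (fun z => e.symm (f (e z)))
      ((e.symm : X →L[ℝ] E).comp (A.comp (e : E →L[ℝ] X))) 0 := by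
    have h1 : HasFDerivAt f A (e 0) := by rwa [he0]
    exact e.symm.hasFDerivAt.comp 0 (h1.comp 0 e.hasFDerivAt)
  obtain ⟨V, h, hV, h0, hVN, hh, hh0, hinv⟩ := exists_invariantGraph
    (f := fun z => e.symm (f (e z))) (a := fun z => a (e z)) (b := fun z => b (e z))
    (H := fun z => H (e z))
    (e.symm.contDiff.contDiffAt.comp 0
      (ContDiffAt.comp 0 (by rwa [he0]) e.contDiff.contDiffAt)) (hcd ha) (hcd hb)
    (by simp [hf0]) (fun v => by rw [hfe.fderiv]; exact hA v) (by simpa using ha0)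
    (by simpa using hb0) (by simpa using hH0)
    ((het.eventually hHpos).mono fun z hz hz0 => hz (by simpa using hz0))
    ((het.eventually hHd).mono fun z ⟨H', h1, h2⟩ =>
      ⟨H'.comp (e : E →L[ℝ] X), h1.comp z e.hasFDerivAt, by simpa using h2⟩)
    (het hN)
  refine ⟨e.symm ⁻¹' V, fun p => h (e.symm p), hV.preimage e.symm.continuous, by simpa using h0,
    fun p hp => by simpa using hVN hp, hh.comp e.symm.contDiff.contDiffOn (mapsTo_preimage _ _),
    by simpa using hh0, fun p hp => ?_⟩
  have hd : HasFDerivAt h (fderiv ℝ h (e.symm p)) (e.symm p) :=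
    ((hh.contDiffAt (hV.mem_nhds hp)).differentiableAt two_ne_zero).hasFDerivAt
  have hd' : HasFDerivAt (fun p => h (e.symm p)) _ p := hd.comp p e.symm.hasFDerivAt
  rw [hd'.fderiv]
  simpa using hinv _ hp

/-- `Dh` is Lipschitz near 0, so it varies by at most `K‖p‖` along the segment from 0 to `p`; the
mean value inequality supplies the second factor `‖p‖`. -/
theorem isBigO_sub_fderiv_of_contDiffAt_two {h : X → ℝ} (hh : ContDiffAt ℝ 2 h 0) :
    (fun p => h p - h 0 - fderiv ℝ h 0 p) =O[𝓝 0] fun p => ‖p‖ ^ 2 := by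
  obtain ⟨K, s, hs, hlip⟩ := (hh.fderiv_right (m := 1)
    (by norm_num [one_add_one_eq_two])).exists_lipschitzOnWith
  obtain ⟨r, hr, hball⟩ := Metric.eventually_nhds_iff_ball.1
    ((hh.eventually (by simp)).and (eventually_mem_set.2 hs))
  refine IsBigO.of_bound K ?_
  filter_upwards [Metric.ball_mem_nhds 0 hr] with p hp
  have hsub : segment ℝ 0 p ⊆ Metric.closedBall 0 ‖p‖ :=
    (convex_closedBall _ _).segment_subset (by simp) (by simp)
  have hsub' : Metric.closedBall 0 ‖p‖ ⊆ Metric.ball (0 : X) r :=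
    Metric.closedBall_subset_ball (by simpa using hp)
  have h1 := Convex.norm_image_sub_le_of_norm_fderiv_le' (𝕜 := ℝ) (f := h) (φ := fderiv ℝ h 0)
    (C := K * ‖p‖) (s := segment ℝ 0 p)
    (fun z hz => (hball z (hsub' (hsub hz))).1.differentiableAt two_ne_zero)
    (fun z hz => by
      have := hlip.dist_le_mul z (hball z (hsub' (hsub hz))).2 0 (mem_of_mem_nhds hs)
      rw [dist_eq_norm, dist_zero_right] at this
      exact this.trans (mul_le_mul_of_nonneg_left (by simpa using hsub hz) K.2))
    (convex_segment _ _) (left_mem_segment ℝ _ _) (right_mem_segment ℝ _ _)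
  rw [sub_zero, mul_assoc, ← sq] at h1
  simpa using h1

end SkewProduct

/-! ### Primitives of functions changing sign at the origin -/

theorem integral_pos_of_sign {g : ℝ → ℝ} {r : ℝ} (hc : ContinuousOn g (Ioo (-r) r))
    (hpos : ∀ x ∈ Ioo 0 r, 0 < g x) (hneg : ∀ x ∈ Ioo (-r) 0, g x < 0) {x : ℝ}
    (hx : x ∈ Ioo (-r) r) (hx0 : x ≠ 0) : 0 < ∫ s in (0 : ℝ)..x, g s := by
  have hr : 0 < r := by linarith [hx.1, hx.2]
  rcases lt_or_gt_of_ne hx0 with hlt | hgt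
  · rw [intervalIntegral.integral_symm, ← intervalIntegral.integral_neg]
    refine intervalIntegral.intervalIntegral_pos_of_pos_on (ContinuousOn.intervalIntegrable ?_)
      (fun s hs => neg_pos.2 (hneg s ⟨hx.1.trans hs.1, hs.2⟩)) hlt
    rw [uIcc_of_le hlt.le]
    exact (hc.mono fun s hs => ⟨hx.1.trans_le hs.1, hs.2.trans_lt hr⟩).neg
  · refine intervalIntegral.intervalIntegral_pos_of_pos_on (ContinuousOn.intervalIntegrable ?_)
      (fun s hs => hpos s ⟨hs.1, hs.2.trans hx.2⟩) hgt
    rw [uIcc_of_le hgt.le]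
    exact hc.mono fun s hs => ⟨by linarith [hs.1], hs.2.trans_lt hx.2⟩

theorem hasDerivAt_integral_of_continuousOn {g : ℝ → ℝ} {r : ℝ}
    (hc : ContinuousOn g (Ioo (-r) r)) {x : ℝ} (hx : x ∈ Ioo (-r) r) :
    HasDerivAt (fun x => ∫ s in (0 : ℝ)..x, g s) (g x) x := by
  have hr : (0 : ℝ) ∈ Ioo (-r) r := ⟨by linarith [hx.1, hx.2], by linarith [hx.1, hx.2]⟩
  exact intervalIntegral.integral_hasDerivAt_right
    (hc.mono (ordConnected_Ioo.uIcc_subset hr hx)).intervalIntegrable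
    (hc.stronglyMeasurableAtFilter isOpen_Ioo x hx) (hc.continuousAt (isOpen_Ioo.mem_nhds hx))

/-! ### The Keen system with zero interest rate as a skew product -/

section Keen

variable {α β δ ν : ℝ} {Φ κ : ℝ → ℝ} {ω₀ l₀ d₀ π₀ : ℝ}

/-- The wage–employment subsystem in coordinates centred at `(ω₀, l₀)`. -/
noncomputable def keenPlane (α β δ ν : ℝ) (Φ κ : ℝ → ℝ) (ω₀ l₀ : ℝ) (p : ℝ × ℝ) : ℝ × ℝ :=
  ((ω₀ + p.1) * (Φ (l₀ + p.2) - α), (l₀ + p.2) * (κ (1 - (ω₀ + p.1)) / ν - α - β - δ))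

/-- The coefficient of the debt ratio in its own equation. -/
noncomputable def keenRate (δ ν : ℝ) (κ : ℝ → ℝ) (ω₀ : ℝ) (p : ℝ × ℝ) : ℝ :=
  δ - κ (1 - (ω₀ + p.1)) / ν

/-- The inhomogeneous term of the debt equation in coordinates centred at `(ω₀, l₀, d₀)`. -/
noncomputable def keenForcing (δ ν : ℝ) (κ : ℝ → ℝ) (ω₀ d₀ : ℝ) (p : ℝ × ℝ) : ℝ :=
  d₀ * keenRate δ ν κ ω₀ p + κ (1 - (ω₀ + p.1)) - (1 - (ω₀ + p.1))

/-- The only place where `r = 0` enters: debt drops out of the profit share, so the planar field is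
autonomous and the debt equation is affine in debt. -/
theorem translateField_keenField_zero :
    translateField (keenField 0 α β δ ν Φ κ) ((ω₀, l₀), d₀) = fun x =>
      (keenPlane α β δ ν Φ κ ω₀ l₀ x.1,
        keenRate δ ν κ ω₀ x.1 * x.2 + keenForcing δ ν κ ω₀ d₀ x.1) := by
  ext x
  · simp [translateField, keenField, keenPlane]
  · simp [translateField, keenField, keenPlane]
  · simp only [translateField, keenField, keenRate, keenForcing, Prod.fst_add, Prod.snd_add,
      zero_mul, sub_zero]
    ring

theorem hasFDerivAt_shift_profit (hω₀ : ω₀ = 1 - π₀) (hκ : DifferentiableAt ℝ κ π₀) :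
    HasFDerivAt (fun p : ℝ × ℝ => κ (1 - (ω₀ + p.1)))
      (-(deriv κ π₀ • ContinuousLinearMap.fst ℝ ℝ ℝ)) 0 := by
  have h1 : HasFDerivAt (fun p : ℝ × ℝ => 1 - (ω₀ + p.1)) (-ContinuousLinearMap.fst ℝ ℝ ℝ) 0 :=
    (hasFDerivAt_fst.const_add ω₀).const_sub 1
  have h2 : HasDerivAt κ (deriv κ π₀) (1 - (ω₀ + (0 : ℝ × ℝ).1)) := by
    have : 1 - (ω₀ + (0 : ℝ × ℝ).1) = π₀ := by simp [hω₀]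
    rw [this]
    exact hκ.hasDerivAt
  have h := h2.comp_hasFDerivAt (0 : ℝ × ℝ) h1
  rwa [smul_neg] at h

theorem hasFDerivAt_keenPlane (hΦl₀ : Φ l₀ = α) (hν : 0 < ν) (hπ₀ : κ π₀ = ν * (α + β + δ))
    (hω₀ : ω₀ = 1 - π₀) (hΦ : DifferentiableAt ℝ Φ l₀) (hκ : DifferentiableAt ℝ κ π₀) :
    HasFDerivAt (keenPlane α β δ ν Φ κ ω₀ l₀)
      (((ω₀ * deriv Φ l₀) • ContinuousLinearMap.snd ℝ ℝ ℝ).prod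
        (-(l₀ * deriv κ π₀ / ν) • ContinuousLinearMap.fst ℝ ℝ ℝ)) 0 := by
  have h1 : HasFDerivAt (fun p : ℝ × ℝ => ω₀ + p.1) (ContinuousLinearMap.fst ℝ ℝ ℝ) 0 :=
    hasFDerivAt_fst.const_add ω₀
  have h2 : HasFDerivAt (fun p : ℝ × ℝ => l₀ + p.2) (ContinuousLinearMap.snd ℝ ℝ ℝ) 0 :=
    hasFDerivAt_snd.const_add l₀
  have h3 : HasDerivAt Φ (deriv Φ l₀) (l₀ + (0 : ℝ × ℝ).2) := by
    simpa using hΦ.hasDerivAt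
  have h4 := (h3.comp_hasFDerivAt (0 : ℝ × ℝ) h2).sub_const α
  have h5 := ((((hasFDerivAt_shift_profit hω₀ hκ).mul_const ν⁻¹).sub_const α).sub_const
    β).sub_const δ
  have h6 := (h1.mul h4).prodMk (h2.mul h5)
  have hκ0 : κ (1 - ω₀) = ν * (α + β + δ) := by rw [← hπ₀, hω₀, sub_sub_cancel]
  convert! h6 using 1
  ext <;> simp [hΦl₀, hκ0]
  all_goals field_simp
  all_goals ring

theorem keenRate_zero (hν : 0 < ν) (hπ₀ : κ π₀ = ν * (α + β + δ)) (hω₀ : ω₀ = 1 - π₀) :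
    keenRate δ ν κ ω₀ 0 = -(α + β) := by
  have hκ0 : κ (1 - ω₀) = ν * (α + β + δ) := by rw [← hπ₀, hω₀, sub_sub_cancel]
  simp only [keenRate, Prod.fst_zero, add_zero, hκ0]
  field_simp
  ring

theorem keenForcing_zero (hν : 0 < ν) (hαβ : 0 < α + β) (hπ₀ : κ π₀ = ν * (α + β + δ))
    (hω₀ : ω₀ = 1 - π₀) (hd₀ : d₀ = (ν * (α + β + δ) - π₀) / (α + β)) :
    keenForcing δ ν κ ω₀ d₀ 0 = 0 := by
  have hκ0 : κ (1 - ω₀) = ν * (α + β + δ) := by rw [← hπ₀, hω₀, sub_sub_cancel]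
  rw [keenForcing, keenRate_zero hν hπ₀ hω₀]
  simp only [Prod.fst_zero, add_zero, hκ0, hd₀]
  rw [hω₀]
  field_simp
  ring

theorem hasFDerivAt_keenRate (hω₀ : ω₀ = 1 - π₀) (hκ : DifferentiableAt ℝ κ π₀) :
    HasFDerivAt (keenRate δ ν κ ω₀) ((deriv κ π₀ / ν) • ContinuousLinearMap.fst ℝ ℝ ℝ) 0 := by
  have h := ((hasFDerivAt_shift_profit hω₀ hκ).mul_const ν⁻¹).const_sub δ
  convert! h using 1
  ext <;> simp
  ring

theorem hasFDerivAt_keenForcing (hν : 0 < ν) (hω₀ : ω₀ = 1 - π₀) (hκ : DifferentiableAt ℝ κ π₀) :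
    HasFDerivAt (keenForcing δ ν κ ω₀ d₀)
      (keenK₂ ν κ π₀ d₀ • ContinuousLinearMap.fst ℝ ℝ ℝ) 0 := by
  have h1 : HasFDerivAt (fun p : ℝ × ℝ => 1 - (ω₀ + p.1)) (-ContinuousLinearMap.fst ℝ ℝ ℝ) 0 :=
    (hasFDerivAt_fst.const_add ω₀).const_sub 1
  have h := (((hasFDerivAt_keenRate (δ := δ) (ν := ν) hω₀ hκ).const_mul d₀).add
    (hasFDerivAt_shift_profit hω₀ hκ)).sub h1
  convert! h using 1
  ext <;> simp [keenK₂]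
  field_simp
  ring

theorem contDiffAt_shift_profit (hω₀ : ω₀ = 1 - π₀) (hκ : ContDiffAt ℝ 2 κ π₀) :
    ContDiffAt ℝ 2 (fun p : ℝ × ℝ => κ (1 - (ω₀ + p.1))) 0 := by
  refine ContDiffAt.comp (g := κ) (0 : ℝ × ℝ) (by simpa [hω₀] using hκ) ?_
  fun_prop

theorem contDiffAt_keenPlane (hω₀ : ω₀ = 1 - π₀) (hΦ : ContDiffAt ℝ 2 Φ l₀)
    (hκ : ContDiffAt ℝ 2 κ π₀) : ContDiffAt ℝ 2 (keenPlane α β δ ν Φ κ ω₀ l₀) 0 := by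
  have h1 : ContDiffAt ℝ 2 (fun p : ℝ × ℝ => Φ (l₀ + p.2)) 0 :=
    ContDiffAt.comp (g := Φ) (0 : ℝ × ℝ) (by simpa using hΦ) (by fun_prop)
  have h2 := contDiffAt_shift_profit hω₀ hκ
  unfold keenPlane
  exact ((contDiffAt_const.add contDiffAt_fst).mul (h1.sub contDiffAt_const)).prodMk
    ((contDiffAt_const.add contDiffAt_snd).mul
      ((((h2.div_const ν).sub contDiffAt_const).sub contDiffAt_const).sub contDiffAt_const))

theorem contDiffAt_keenRate (hω₀ : ω₀ = 1 - π₀) (hκ : ContDiffAt ℝ 2 κ π₀) :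
    ContDiffAt ℝ 2 (keenRate δ ν κ ω₀) 0 :=
  contDiffAt_const.sub ((contDiffAt_shift_profit hω₀ hκ).div_const ν)

theorem contDiffAt_keenForcing (hω₀ : ω₀ = 1 - π₀) (hκ : ContDiffAt ℝ 2 κ π₀) :
    ContDiffAt ℝ 2 (keenForcing δ ν κ ω₀ d₀) 0 := by
  have h1 : ContDiffAt ℝ 2 (fun p : ℝ × ℝ => 1 - (ω₀ + p.1)) 0 := by fun_prop
  exact ((contDiffAt_const.mul (contDiffAt_keenRate hω₀ hκ)).add
    (contDiffAt_shift_profit hω₀ hκ)).sub h1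

/-- The wage–employment subsystem has a conserved quantity with a strict minimum at the
equilibrium. -/
theorem exists_keenPlane_conserved (hν : 0 < ν) (hΦ : ContinuousOn Φ (Ioo 0 1))
    (hΦm : StrictMonoOn Φ (Ioo 0 1)) (hκ : Continuous κ) (hκm : StrictMono κ)
    (hl₀ : l₀ ∈ Ioo (0 : ℝ) 1) (hΦl₀ : Φ l₀ = α) (hπ₀ : κ π₀ = ν * (α + β + δ))
    (hω₀ : ω₀ = 1 - π₀) (hω₀pos : 0 < ω₀) :
    ∃ H : ℝ × ℝ → ℝ, H 0 = 0 ∧ (∀ᶠ p in 𝓝 0, p ≠ 0 → 0 < H p) ∧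
      ∀ᶠ p in 𝓝 0, ∃ H' : ℝ × ℝ →L[ℝ] ℝ, HasFDerivAt H H' p ∧
        H' (keenPlane α β δ ν Φ κ ω₀ l₀ p) = 0 := by
  obtain ⟨r, hr, hrl, hrl', hrω⟩ : ∃ r > 0, r ≤ l₀ ∧ r ≤ 1 - l₀ ∧ r ≤ ω₀ :=
    ⟨min l₀ (min (1 - l₀) ω₀), lt_min hl₀.1 (lt_min (sub_pos.2 hl₀.2) hω₀pos),
      min_le_left _ _, (min_le_right _ _).trans (min_le_left _ _),
      (min_le_right _ _).trans (min_le_right _ _)⟩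
  have hlmem : ∀ x ∈ Ioo (-r) r, l₀ + x ∈ Ioo (0 : ℝ) 1 := fun x hx =>
    ⟨by linarith [hx.1], by linarith [hx.2]⟩
  have hωmem : ∀ x ∈ Ioo (-r) r, 0 < ω₀ + x := fun x hx => by linarith [hx.1]
  -- Separation of variables: `g₁(λ) λ' + g₂(ω) ω' = 0` along the field. Monotonicity of `Φ` and `κ`
  -- gives both functions the sign of their argument, so their primitives are positive away from 0.
  set g₁ : ℝ → ℝ := fun x => (Φ (l₀ + x) - α) / (l₀ + x) with hg₁
  set g₂ : ℝ → ℝ := fun x => -(κ (1 - (ω₀ + x)) / ν - α - β - δ) / (ω₀ + x) with hg₂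
  have hc₁ : ContinuousOn g₁ (Ioo (-r) r) := by
    refine ContinuousOn.div ((hΦ.comp (by fun_prop) hlmem).sub continuousOn_const) (by fun_prop)
      fun x hx => (hlmem x hx).1.ne'
  have hc₂ : ContinuousOn g₂ (Ioo (-r) r) := by
    refine ContinuousOn.div (Continuous.continuousOn ?_) (by fun_prop) fun x hx => (hωmem x hx).ne'
    fun_prop
  have hp₁ : ∀ x ∈ Ioo 0 r, 0 < g₁ x := fun x hx => by
    have hx' : x ∈ Ioo (-r) r := ⟨by linarith [hx.1], hx.2⟩
    refine div_pos (sub_pos.2 ?_) (hlmem x hx').1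
    rw [← hΦl₀]
    exact hΦm hl₀ (hlmem x hx') (by linarith [hx.1])
  have hn₁ : ∀ x ∈ Ioo (-r) 0, g₁ x < 0 := fun x hx => by
    have hx' : x ∈ Ioo (-r) r := ⟨hx.1, by linarith [hx.2]⟩
    refine div_neg_of_neg_of_pos (sub_neg.2 ?_) (hlmem x hx').1
    rw [← hΦl₀]
    exact hΦm (hlmem x hx') hl₀ (by linarith [hx.2])
  have hp₂ : ∀ x ∈ Ioo 0 r, 0 < g₂ x := fun x hx => by
    have hx' : x ∈ Ioo (-r) r := ⟨by linarith [hx.1], hx.2⟩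
    refine div_pos ?_ (hωmem x hx')
    have h1 : κ (1 - (ω₀ + x)) < ν * (α + β + δ) := by
      rw [← hπ₀]
      exact hκm (by linarith [hx.1])
    have h2 := (div_lt_iff₀' hν).2 h1
    linarith
  have hn₂ : ∀ x ∈ Ioo (-r) 0, g₂ x < 0 := fun x hx => by
    have hx' : x ∈ Ioo (-r) r := ⟨hx.1, by linarith [hx.2]⟩
    refine div_neg_of_neg_of_pos ?_ (hωmem x hx')
    have h1 : ν * (α + β + δ) < κ (1 - (ω₀ + x)) := by
      rw [← hπ₀]
      exact hκm (by linarith [hx.2])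
    have h2 := (lt_div_iff₀' hν).2 h1
    linarith
  set G₁ : ℝ → ℝ := fun x => ∫ s in (0 : ℝ)..x, g₁ s with hG₁
  set G₂ : ℝ → ℝ := fun x => ∫ s in (0 : ℝ)..x, g₂ s with hG₂
  have hnhds : ∀ᶠ p : ℝ × ℝ in 𝓝 0, p.1 ∈ Ioo (-r) r ∧ p.2 ∈ Ioo (-r) r :=
    (continuous_fst.continuousAt.eventually (Ioo_mem_nhds (by simpa using hr) (by simpa))).and
      (continuous_snd.continuousAt.eventually (Ioo_mem_nhds (by simpa using hr) (by simpa)))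
  refine ⟨fun p => G₂ p.1 + G₁ p.2, by simp [hG₁, hG₂], ?_, ?_⟩
  · filter_upwards [hnhds] with p hp hp0
    have e₁ : p.2 ≠ 0 → 0 < G₁ p.2 := integral_pos_of_sign hc₁ hp₁ hn₁ hp.2
    have e₂ : p.1 ≠ 0 → 0 < G₂ p.1 := integral_pos_of_sign hc₂ hp₂ hn₂ hp.1
    by_cases h1 : p.1 = 0
    · have h2 : p.2 ≠ 0 := fun h2 => hp0 (Prod.ext h1 h2)
      simpa [h1, hG₂] using e₁ h2
    · by_cases h2 : p.2 = 0
      · simpa [h2, hG₁] using e₂ h1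
      · exact add_pos (e₂ h1) (e₁ h2)
  · filter_upwards [hnhds] with p hp
    have d₁ : HasDerivAt G₁ (g₁ p.2) p.2 := hasDerivAt_integral_of_continuousOn hc₁ hp.2
    have d₂ : HasDerivAt G₂ (g₂ p.1) p.1 := hasDerivAt_integral_of_continuousOn hc₂ hp.1
    refine ⟨_, (d₂.comp_hasFDerivAt p hasFDerivAt_fst).add
      (d₁.comp_hasFDerivAt p hasFDerivAt_snd), ?_⟩
    have n₁ := (hlmem p.2 hp.2).1.ne'
    have n₂ := (hωmem p.1 hp.1).ne'
    simp only [keenPlane, hg₁, hg₂, add_apply, smul_apply,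
      ContinuousLinearMap.coe_fst', ContinuousLinearMap.coe_snd', smul_eq_mul]
    field_simp
    ring

/-- The isomorphism of `ℂ` with the plane which rescales the coordinate axes. -/
noncomputable def complexScaling {s t : ℝ} (hs : s ≠ 0) (ht : t ≠ 0) : ℂ ≃L[ℝ] ℝ × ℝ :=
  LinearEquiv.toContinuousLinearEquiv
    { toFun := fun z => (s * z.re, t * z.im)
      invFun := fun p => ⟨p.1 / s, p.2 / t⟩
      map_add' := fun z w => by ext <;> simp <;> ring
      map_smul' := fun c z => by ext <;> simp <;> ring
      left_inv := fun z => by apply Complex.ext <;> field_simp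
      right_inv := fun p => by ext <;> field_simp }

/-- Scaling the axes by `√K₀` and `√K₁` equalizes the two off-diagonal entries to `±√(K₀K₁)`, an
infinitesimal rotation. The model `ℂ` supplies the Euclidean inner product, the norm of `ℝ × ℝ`
being the sup norm. -/
theorem inner_complexScaling_symm_eq_zero {K₀ K₁ : ℝ} (h₀ : 0 < K₀) (h₁ : 0 < K₁) (z : ℂ) :
    inner ℝ z ((complexScaling (Real.sqrt_pos.2 h₀).ne' (Real.sqrt_pos.2 h₁).ne').symm
      (((K₀ • ContinuousLinearMap.snd ℝ ℝ ℝ).prod (-K₁ • ContinuousLinearMap.fst ℝ ℝ ℝ))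
        (complexScaling (Real.sqrt_pos.2 h₀).ne' (Real.sqrt_pos.2 h₁).ne' z))) = 0 := by
  have n₀ := (Real.sqrt_pos.2 h₀).ne'
  have n₁ := (Real.sqrt_pos.2 h₁).ne'
  have e₀ := Real.sq_sqrt h₀.le
  have e₁ := Real.sq_sqrt h₁.le
  have key : ∀ p : ℝ × ℝ, (complexScaling n₀ n₁).symm p = ⟨p.1 / √K₀, p.2 / √K₁⟩ := fun p => rfl
  have key' : complexScaling n₀ n₁ z = (√K₀ * z.re, √K₁ * z.im) := rfl
  rw [key, key', Complex.inner]
  simp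
  field_simp
  rw [e₀, e₁]
  ring

/-- The functional whose kernel is the center subspace of the linearized Keen system. -/
theorem centerSubspace_skewProduct {K₀ K₁ K₂ γ : ℝ} (h₀ : 0 < K₀) (h₁ : 0 < K₁) (hγ : 0 < γ) :
    centerSubspace ((((K₀ • ContinuousLinearMap.snd ℝ ℝ ℝ).prod
        (-K₁ • ContinuousLinearMap.fst ℝ ℝ ℝ)).comp (ContinuousLinearMap.fst ℝ (ℝ × ℝ) ℝ)).prod
        (-γ • ContinuousLinearMap.snd ℝ (ℝ × ℝ) ℝ + (K₂ • ContinuousLinearMap.fst ℝ ℝ ℝ).comp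
          (ContinuousLinearMap.fst ℝ (ℝ × ℝ) ℝ)) : (ℝ × ℝ) × ℝ →ₗ[ℝ] (ℝ × ℝ) × ℝ) =
      (((γ * K₂ / (γ ^ 2 + K₀ * K₁)) • LinearMap.fst ℝ ℝ ℝ +
        (-(K₀ * K₂) / (γ ^ 2 + K₀ * K₁)) • LinearMap.snd ℝ ℝ ℝ).graph) := by
  have hD : γ ^ 2 + K₀ * K₁ ≠ 0 := by positivity
  have hΩ : (√(K₀ * K₁)) ^ 2 = K₀ * K₁ := Real.sq_sqrt (by positivity)
  set L : ℝ × ℝ →ₗ[ℝ] ℝ := (γ * K₂ / (γ ^ 2 + K₀ * K₁)) • LinearMap.fst ℝ ℝ ℝ +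
    (-(K₀ * K₂) / (γ ^ 2 + K₀ * K₁)) • LinearMap.snd ℝ ℝ ℝ with hL
  have hLapp : ∀ p : ℝ × ℝ, L p = γ * K₂ / (γ ^ 2 + K₀ * K₁) * p.1 +
    -(K₀ * K₂) / (γ ^ 2 + K₀ * K₁) * p.2 := fun p => rfl
  -- The coefficients of `L` solve `γ h₁₀ = K₂ + K₁ h₀₁` and `γ h₀₁ = -K₀ h₁₀`, which says that `d -
  -- L(ω, λ)` is a left eigenvector for `-γ`.
  rw [centerSubspace_eq_ker (ℓ := LinearMap.snd ℝ (ℝ × ℝ) ℝ - L.comp (LinearMap.fst ℝ (ℝ × ℝ) ℝ))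
    (γ := -γ) (Ω := √(K₀ * K₁)) (neg_ne_zero.2 hγ.ne') (Real.sqrt_pos.2 (by positivity)).ne']
  · ext v
    simp [LinearMap.mem_graph_iff, sub_eq_zero]
  · intro v
    simp [hLapp]
    field_simp
    ring
  · intro v hv
    have hv' : v.2 = L v.1 := by simpa [sub_eq_zero] using hv
    rw [hLapp] at hv'
    rw [hΩ]
    ext
    · simp
      ring
    · simp
      ring
    · simp [hv']
      field_simp
      ring

end Keen

/-! ### Existence, first-order coefficients and non-tangency for the Keen system -/

theorem theorem3p1
    (α β δ ν : ℝ) (Φ κ : ℝ → ℝ) (hν : 0 < ν) (hαβ : 0 < α + β)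
    (hΦ : ContDiffOn ℝ 1 Φ (Ioo 0 1)) (hΦ' : ∀ l ∈ Ioo (0 : ℝ) 1, 0 < deriv Φ l)
    (hκ : ContDiff ℝ 1 κ) (hκ' : ∀ p : ℝ, 0 < deriv κ p)
    (ω₀ l₀ d₀ π₀ : ℝ)
    (hl₀ : l₀ ∈ Ioo (0 : ℝ) 1) (hΦl₀ : Φ l₀ = α)
    (hπ₀ : κ π₀ = ν * (α + β + δ))
    (hω₀ : ω₀ = 1 - π₀) (hω₀pos : 0 < ω₀)
    (hd₀ : d₀ = (ν * (α + β + δ) - π₀) / (α + β))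
    (hΦ2 : ContDiffAt ℝ 2 Φ l₀) (hκ2 : ContDiffAt ℝ 2 κ π₀) :
    (∃ (U : Set (ℝ × ℝ)) (h : ℝ × ℝ → ℝ),
      IsLocalCenterManifold
        (translateField (keenField 0 α β δ ν Φ κ) ((ω₀, l₀), d₀)) U h) ∧
    ∀ (U : Set (ℝ × ℝ)) (h : ℝ × ℝ → ℝ),
      IsLocalCenterManifold
        (translateField (keenField 0 α β δ ν Φ κ) ((ω₀, l₀), d₀)) U h →
      h (0, 0) = 0 ∧
      (fun p : ℝ × ℝ => h p -
        ((α + β) * keenK₂ ν κ π₀ d₀ / ((α + β) ^ 2 + keenΩsq ν Φ κ ω₀ l₀ π₀) * p.1 +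
          -(ω₀ * deriv Φ l₀ * keenK₂ ν κ π₀ d₀) /
            ((α + β) ^ 2 + keenΩsq ν Φ κ ω₀ l₀ π₀) * p.2))
        =O[𝓝 0] (fun p : ℝ × ℝ => ‖p‖ ^ 2) ∧
      (keenK₂ ν κ π₀ d₀ ≠ 0 →
        graphTangent h ≠ Submodule.prod (⊤ : Submodule ℝ (ℝ × ℝ)) (⊥ : Submodule ℝ ℝ)) := by
  rw [translateField_keenField_zero]
  set K₀ := ω₀ * deriv Φ l₀ with hK₀
  set K₁ := l₀ * deriv κ π₀ / ν with hK₁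
  set K₂ := keenK₂ ν κ π₀ d₀ with hK₂
  set γ := α + β with hγ
  have hK₀pos : 0 < K₀ := mul_pos hω₀pos (hΦ' l₀ hl₀)
  have hK₁pos : 0 < K₁ := div_pos (mul_pos hl₀.1 (hκ' π₀)) hν
  have hΩsq : keenΩsq ν Φ κ ω₀ l₀ π₀ = K₀ * K₁ := by
    simp only [keenΩsq, hK₀, hK₁]
    ring
  rw [hΩsq]
  have hκd : DifferentiableAt ℝ κ π₀ := hκ.differentiable one_ne_zero π₀
  have hf' := hasFDerivAt_keenPlane (α := α) (β := β) (δ := δ) hΦl₀ hν hπ₀ hω₀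
    (hΦ2.differentiableAt two_ne_zero) hκd
  have ha' := hasFDerivAt_keenRate (δ := δ) (ν := ν) hω₀ hκd
  have hb' := hasFDerivAt_keenForcing (δ := δ) (d₀ := d₀) hν hω₀ hκd
  have hr0 : keenRate δ ν κ ω₀ 0 = -γ := keenRate_zero hν hπ₀ hω₀
  have hb0 : keenForcing δ ν κ ω₀ d₀ 0 = 0 := keenForcing_zero hν hαβ hπ₀ hω₀ hd₀
  have hf0 : keenPlane α β δ ν Φ κ ω₀ l₀ 0 = 0 := by
    have hκ0 : κ (1 - ω₀) = ν * (α + β + δ) := by rw [← hπ₀, hω₀, sub_sub_cancel]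
    simp only [keenPlane, Prod.fst_zero, Prod.snd_zero, add_zero, hΦl₀, hκ0]
    ext <;> simp
    right
    field_simp
    ring
  have hF' := (hasFDerivAt_skewProduct hf' ha'.differentiableAt hb').fderiv
  rw [hr0] at hF'
  have hcenter := centerSubspace_skewProduct (K₂ := K₂) hK₀pos hK₁pos hαβ
  refine ⟨?_, fun U h hU => ⟨hU.map_zero, ?_⟩⟩
  · obtain ⟨H, hH0, hHpos, hHd⟩ := exists_keenPlane_conserved (α := α) (β := β) (δ := δ) hν
      hΦ.continuousOn
      (strictMonoOn_of_deriv_pos (convex_Ioo 0 1) hΦ.continuousOn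
        (by rw [interior_Ioo]; exact hΦ')) hκ.continuous (strictMono_of_deriv_pos hκ') hl₀ hΦl₀
      hπ₀ hω₀ hω₀pos
    -- Shrinking to where the rate is bounded provides the Lipschitz constant for local invariance.
    have hN : ∀ᶠ p in 𝓝 0, ‖keenRate δ ν κ ω₀ p‖ < ‖keenRate δ ν κ ω₀ 0‖ + 1 :=
      ha'.continuousAt.norm.eventually (gt_mem_nhds (lt_add_one _))
    obtain ⟨V, h, hV, h0V, hVN, hh, hh0, hinv⟩ := exists_invariantGraph_of_equiv
      (complexScaling (Real.sqrt_pos.2 hK₀pos).ne' (Real.sqrt_pos.2 hK₁pos).ne')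
      (contDiffAt_keenPlane hω₀ hΦ2 hκ2) (contDiffAt_keenRate (δ := δ) (ν := ν) hω₀ hκ2)
      (contDiffAt_keenForcing (d₀ := d₀) hω₀ hκ2) hf0 hf'
      (inner_complexScaling_symm_eq_zero hK₀pos hK₁pos) (by rw [hr0]; linarith) hb0 hH0 hHpos hHd
      hN
    have hhat := hh.contDiffAt (hV.mem_nhds h0V)
    refine ⟨V, h, hV, h0V, by simp [hf0, hb0], hh0, hh, ?_, ?_⟩
    -- The linearized invariance equation on the two basis vectors is a linear system for the
    -- partial derivatives of `h`, with determinant `γ² + K₀K₁ > 0`.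
    · have hlin := fderiv_invariantGraph hf' hf0 ha'.differentiableAt hb' hhat hh0
        (eventually_of_mem (hV.mem_nhds h0V) hinv)
      rw [hF', hcenter, graphTangent]
      congr 1
      have e1 := hlin (1, 0)
      have e2 := hlin (0, 1)
      have s1 : ∀ c : ℝ, fderiv ℝ h 0 (0, c) = c * fderiv ℝ h 0 (0, 1) := fun c => by
        rw [← smul_eq_mul, ← map_smul]; simp
      have s2 : ∀ c : ℝ, fderiv ℝ h 0 (c, 0) = c * fderiv ℝ h 0 (1, 0) := fun c => by
        rw [← smul_eq_mul, ← map_smul]; simp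
      rw [hr0] at e1 e2
      simp at e1 e2
      rw [s1] at e1
      rw [s2] at e2
      rw [← hK₁, ← hK₂] at e1
      rw [← hK₀] at e2
      have hD : γ ^ 2 + K₀ * K₁ ≠ 0 := by positivity
      ext
      · simp
        rw [eq_div_iff hD]
        linear_combination γ * e1 + K₁ * e2
      · simp
        rw [eq_div_iff hD]
        linear_combination γ * e2 - K₀ * e1
    · intro a b x hx hxU t₀ ht₀ hmem
      exact mem_graphOver_of_invariantGraph (C := ⟨‖keenRate δ ν κ ω₀ 0‖ + 1, by positivity⟩) hV
        (hh.differentiableOn two_ne_zero) (fun p hp => (hVN hp).le) hinv hx hxU ht₀ hmem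
  -- Tangency to the center subspace alone determines `Dh(0)`; invariance plays no role here.
  · have htan := hU.tangent
    rw [hF', hcenter, graphTangent] at htan
    have hDh : ∀ v, fderiv ℝ h 0 v = γ * K₂ / (γ ^ 2 + K₀ * K₁) * v.1 +
        -(K₀ * K₂) / (γ ^ 2 + K₀ * K₁) * v.2 := by
      intro v
      have h1 : ((v, fderiv ℝ h 0 v) : (ℝ × ℝ) × ℝ) ∈ (fderiv ℝ h 0 : ℝ × ℝ →ₗ[ℝ] ℝ).graph := by
        simp [LinearMap.mem_graph_iff]
      rw [htan] at h1
      simpa [LinearMap.mem_graph_iff] using h1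
    refine ⟨?_, fun hne heq => ?_⟩
    · have h2 := isBigO_sub_fderiv_of_contDiffAt_two
        (hU.contDiffOn.contDiffAt (hU.isOpen.mem_nhds hU.zero_mem))
      simpa only [hU.map_zero, sub_zero, hDh] using h2
    -- In the direction `(1, 0)` the slope is `γK₂/(γ² + K₀K₁)`, nonzero when `K₂ ≠ 0`.
    · have h3 : (((1, 0), fderiv ℝ h 0 (1, 0)) : (ℝ × ℝ) × ℝ) ∈ graphTangent h := by
        simp [graphTangent, LinearMap.mem_graph_iff]
      rw [heq] at h3
      have h4 : fderiv ℝ h 0 (1, 0) = 0 := by simpa using h3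
      rw [hDh] at h4
      have hD : γ ^ 2 + K₀ * K₁ ≠ 0 := by positivity
      simp [hαβ.ne', hne, hD] at h4
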